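/- **Setting.** Let $d,T\ge 1$ and $m>0$. Rewards follow a canonical exponential family: there are a measure $\nu$ on $\mathbb R$, a measurable $c:\mathbb R\to\mathbb R$ and a $C^2$ function $b:\mathbb R\to\mathbb R$ such that $d\mathbb P_\theta(r\mid a)=\exp(r\,a^\top\theta-b(a^\top\theta)+c(r))\,d\nu(r)$ is a probability measure for all values of $a^\top\theta\in\mathbb R$. The mean function $\mu=b'$ is twice differentiable, $k_\mu$-Lipschitz, self-concordant ($|\mu''|\le\mu'$), and $c_\mu=\inf\{\mu'(a^\top\theta):\|\theta\|_2\le S,\ \|a\|_2\le 1\}>0$. In round $t=1,\dots,T$ the agent observes an action set $\mathcal A_t$ in the unit ball of $\mathbb R^d$ (possibly random), plays $a_t\in\mathcal A_t$, and receives $r_{t+1}$, whose conditional law given the past (including $a_t$) is $\mathbb P_{\theta^\star_t}(\cdot\mid a_t)$. Almost surely $0\le r_{t+1}\le m$. The deterministic parameters satisfy $\|\theta_t^\star\|_2\le S$ and change at most $\Gamma_T$ times during the $T$ rounds. The dynamic regret is $$R_T=\sum_{t=1}^T\Big(\sup_{a\in\mathcal A_t}\mu(a^\top\theta^\star_t)-\mu(a_t^\top\theta^\star_t)\Big).$$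 **Algorithm (D-GLUCB, no projection).** Given $\lambda>0$, $\gamma\in(1/2,1)$, $\delta\in(0,1]$, put $$\bar S=S+\frac{2Sk_\mu+m}{T\lambda(1-\gamma)},\qquad \rho=\frac{\sqrt\lambda}{2m}+\frac{2m}{\sqrt\lambda}\log\frac T\delta+\frac{2m}{\sqrt\lambda}d\log 2+\frac{dm}{\sqrt\lambda}\log\Big(1+\frac{k_\mu(1-T^{-2})}{d\lambda(1-\gamma^2)}\Big),$$ $$\beta_T^\delta=k_\mu\sqrt\lambda\Big(1+\bar S+\sqrt{\tfrac{1+\bar S}{\lambda}}\,\rho+\tfrac{\rho^2}{\lambda}\Big)^{3/2},\qquad V_t=\sum_{s=1}^{t-1}\gamma^{t-1-s}a_sa_s^\top+\frac{\lambda}{c_\mu}I_d .$$ At round $t$, let $\hat\theta_t$ be the minimizer over $\mathbb R^d$ of $-\sum_{s=1}^{t-1}\gamma^{t-1-s}\log\big(\tfrac{d\mathbb P_\theta}{d\nu}(r_{s+1}\mid a_s)\big)+\frac\lambda2\|\theta\|_2^2$, and let $a_t$ maximize $\mu(a^\top\hat\theta_t)+\frac{\beta_T^\delta}{\sqrt{c_\mu}}\|a\|_{V_t^{-1}}$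 over $a\in\mathcal A_t$, where $\|a\|_{V_t^{-1}}=\sqrt{a^\top V_t^{-1}a}$. **Theorem.** (1) For every $\gamma\in(1/2,1)$, $\lambda>0$ and $\delta\in(0,1]$, with probability at least $1-\delta$ both of the following hold: $$R_T\le\frac{2m\log T}{1-\gamma}\Gamma_T+\frac{2k_\mu(2Sk_\mu+m)}{\lambda(1-\gamma)}+\frac{2\beta_T^\delta}{\sqrt{c_\mu}}\sqrt{dT}\sqrt{2\max\big(1,\tfrac{c_\mu}{\lambda}\big)}\sqrt{T\log\tfrac1\gamma+\log\Big(1+\frac{c_\mu}{d\lambda(1-\gamma)}\Big)}$$ and $$R_T\le C_1\frac{\Gamma_T}{1-\gamma}+C_2\frac{\beta_T^\delta\sqrt{dT}}{\sqrt{c_\mu}}\sqrt{T\log\tfrac1\gamma+\log\Big(1+\frac1{d\lambda(1-\gamma)}\Big)},$$ with $C_1=2m\log T+\frac{2k_\mu(2Sk_\mu+m)}{\lambda}$ and $C_2=2\sqrt{2\max(1,k_\mu/\lambda)\max(1,k_\mu)}$, which do not depend on $c_\mu$ or $\gamma$ and depend on $T$ only logarithmically. (2) There are a universal exponent $p\in\mathbb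 N$ and, for all $S,k_\mu,m$, a constant $K=K(S,k_\mu,m)$ such that the following holds for all $d\ge1$, $T\ge2$, $\Gamma_T$, $\delta\in(0,1]$ and all environments as above. If the algorithm is run with $\gamma=1-\big(\frac{c_\mu^{1/2}\Gamma_T}{dT}\big)^{2/3}$ and $\lambda=d\log T$, and this $\gamma$ lies in $(1/2,1)$, then with probability at least $1-\delta$ $$R_T\le K\,\log^p(T/\delta)\;c_\mu^{-1/3}d^{2/3}\Gamma_T^{1/3}T^{2/3},$$ that is, $R_T=\widetilde{\mathcal O}\big(c_\mu^{-1/3}d^{2/3}\Gamma_T^{1/3}T^{2/3}\big)$. -/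

import Mathlib

open MeasureTheory ProbabilityTheory
open scoped Matrix

noncomputable section

namespace DGLUCB

/-- Actions and parameters live in `ℝ^d` with the Euclidean norm. -/
abbrev Vec (d : ℕ) : Type := EuclideanSpace ℝ (Fin d)

/-- The density `exp (r x - b(x) + c(r))` of the canonical exponential family, where the natural
parameter is `x = aᵀθ`. -/
def density (b c : ℝ → ℝ) (x r : ℝ) : ℝ := Real.exp (r * x - b x + c r)

/-- The law of the reward when `aᵀθ = x`. -/
def rewardLaw (ν : Measure ℝ) (b c : ℝ → ℝ) (x : ℝ) : Measure ℝ :=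
  ν.withDensity fun r => ENNReal.ofReal (density b c x r)

/-- `inf { μ'(aᵀθ) : ‖θ‖ ≤ S, ‖a‖ ≤ 1 }`. -/
def minSlope (d : ℕ) (S : ℝ) (μ : ℝ → ℝ) : ℝ :=
  sInf {y : ℝ | ∃ θ a : Vec d, ‖θ‖ ≤ S ∧ ‖a‖ ≤ 1 ∧ y = deriv μ (inner ℝ a θ)}

/-- A self-concordant generalized linear reward model in dimension `d` whose mean function
`μ = b'` is `k`-Lipschitz with positive minimal slope on the admissible set of radius `S`. -/
structure RewardModel (d : ℕ) (S k : ℝ) where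
  ν : Measure ℝ
  b : ℝ → ℝ
  c : ℝ → ℝ
  measurable_c : Measurable c
  contDiff_b : ContDiff ℝ 2 b
  isProb : ∀ x : ℝ, IsProbabilityMeasure (rewardLaw ν b c x)
  lipschitz : ∀ x y : ℝ, |deriv b x - deriv b y| ≤ k * |x - y|
  minSlope_pos : 0 < minSlope d S (deriv b)
  differentiable_slope : Differentiable ℝ (deriv (deriv b))
  selfConcordant : ∀ x : ℝ, |deriv (deriv (deriv b)) x| ≤ deriv (deriv b) x

namespace RewardModel

variable {d : ℕ} {S k : ℝ}

/-- The mean (inverse link) function. -/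
def μ (M : RewardModel d S k) : ℝ → ℝ := deriv M.b

/-- The constant `c_μ`. -/
def cμ (M : RewardModel d S k) : ℝ := minSlope d S M.μ

end RewardModel

/-- `T` rounds of interaction, with some policy, between an agent and an abruptly changing
generalized linear environment. In round `t ∈ {1, …, T}` the agent sees `A t`, plays `a t`, and
receives the reward `r (t + 1)`; the parameter changes at most `Γ` times. -/
structure Interaction (d T Γ : ℕ) (S k m : ℝ) (Ω : Type*) [MeasurableSpace Ω]
    extends RewardModel d S k where
  P : Measure Ω
  isProbP : IsProbabilityMeasure P
  /-- `ℱ t` is the information available when `a t` is played. -/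
  ℱ : Filtration ℕ ‹MeasurableSpace Ω›
  /-- The true parameters. -/
  θ : ℕ → Vec d
  /-- The action sets, possibly random. -/
  A : ℕ → Ω → Set (Vec d)
  a : ℕ → Ω → Vec d
  r : ℕ → Ω → ℝ
  norm_θ_le : ∀ t, 1 ≤ t → t ≤ T → ‖θ t‖ ≤ S
  changes_le : {t : ℕ | 1 ≤ t ∧ t + 1 ≤ T ∧ θ (t + 1) ≠ θ t}.ncard ≤ Γ
  norm_action_le : ∀ t, 1 ≤ t → t ≤ T → ∀ ω, ∀ x ∈ A t ω, ‖x‖ ≤ 1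
  a_mem : ∀ t, 1 ≤ t → t ≤ T → ∀ ω, a t ω ∈ A t ω
  measurable_a : ∀ t, 1 ≤ t → t ≤ T → Measurable[ℱ t] (a t)
  measurable_r : ∀ t, 1 ≤ t → t ≤ T → Measurable[ℱ (t + 1)] (r (t + 1))
  r_bounded : ∀ t, 1 ≤ t → t ≤ T → ∀ᵐ ω ∂P, 0 ≤ r (t + 1) ω ∧ r (t + 1) ω ≤ m
  /-- Conditionally on the past and on `a t`, the reward has law `P_{θ t}(· | a t)`. -/
  cond_law : ∀ t, 1 ≤ t → t ≤ T → ∀ B : Set ℝ, MeasurableSet B →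
    P[(r (t + 1) ⁻¹' B).indicator (fun _ => (1 : ℝ)) | ℱ t] =ᵐ[P]
      fun ω => (rewardLaw ν b c (inner ℝ (a t ω) (θ t))).real B

/-- `‖x‖_{V⁻¹} = √(xᵀ V⁻¹ x)`. -/
def invNorm {d : ℕ} (V : Matrix (Fin d) (Fin d) ℝ) (x : Vec d) : ℝ :=
  Real.sqrt (x.ofLp ⬝ᵥ (V⁻¹ *ᵥ x.ofLp))

/-- `S̄ = S + (2 S k + m) / (T λ (1 - γ))`. -/
def Sbar (T : ℕ) (S k m lam γ : ℝ) : ℝ :=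
  S + (2 * S * k + m) / (T * lam * (1 - γ))

/-- The deviation level `ρ_T^δ`. -/
def rho (d T : ℕ) (k m lam γ δ : ℝ) : ℝ :=
  Real.sqrt lam / (2 * m) + 2 * m / Real.sqrt lam * Real.log (T / δ)
    + 2 * m / Real.sqrt lam * (d * Real.log 2)
    + d * m / Real.sqrt lam
      * Real.log (1 + k * (1 - ((T : ℝ) ^ 2)⁻¹) / (d * lam * (1 - γ ^ 2)))

/-- The confidence width `β_T^δ`. -/
def beta (d T : ℕ) (S k m lam γ δ : ℝ) : ℝ :=
  k * Real.sqrt lam *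
    (1 + Sbar T S k m lam γ
      + Real.sqrt ((1 + Sbar T S k m lam γ) / lam) * rho d T k m lam γ δ
      + (rho d T k m lam γ δ / Real.sqrt lam) ^ 2) ^ (3 / 2 : ℝ)

namespace Interaction

variable {d T Γ : ℕ} {S k m : ℝ} {Ω : Type*} [MeasurableSpace Ω]

/-- The exponentially weighted, `ℓ²`-regularized negative log-likelihood at round `t`. -/
def loss (X : Interaction d T Γ S k m Ω) (lam γ : ℝ) (t : ℕ) (ω : Ω) (θ' : Vec d) : ℝ :=
  -(∑ s ∈ Finset.Ico 1 t, γ ^ (t - 1 - s) *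
      Real.log (density X.b X.c (inner ℝ (X.a s ω) θ') (X.r (s + 1) ω)))
    + lam / 2 * ‖θ'‖ ^ 2

/-- `V_t = ∑_{s=1}^{t-1} γ^{t-1-s} a_s a_sᵀ + (λ / c_μ) I`. -/
def V (X : Interaction d T Γ S k m Ω) (lam γ : ℝ) (t : ℕ) (ω : Ω) :
    Matrix (Fin d) (Fin d) ℝ :=
  (∑ s ∈ Finset.Ico 1 t,
      γ ^ (t - 1 - s) • Matrix.vecMulVec (X.a s ω).ofLp (X.a s ω).ofLp)
    + (lam / X.cμ) • (1 : Matrix (Fin d) (Fin d) ℝ)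

/-- The optimistic index of the action `x` at round `t` built on the estimate `θ'`. -/
def ucb (X : Interaction d T Γ S k m Ω) (lam γ δ : ℝ) (t : ℕ) (ω : Ω) (θ' x : Vec d) : ℝ :=
  X.μ (inner ℝ x θ')
    + beta d T S k m lam γ δ / Real.sqrt X.cμ * invNorm (X.V lam γ t ω) x

/-- The policy of the agent is D-GLUCB: every action maximizes the optimistic index built on the
(unprojected) weighted regularized maximum-likelihood estimate. -/
def IsDGLUCB (X : Interaction d T Γ S k m Ω) (lam γ δ : ℝ) : Prop :=
  ∃ θhat : ℕ → Ω → Vec d, ∀ t, 1 ≤ t → t ≤ T → ∀ ω,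
    IsMinOn (X.loss lam γ t ω) Set.univ (θhat t ω) ∧
    IsMaxOn (X.ucb lam γ δ t ω (θhat t ω)) (X.A t ω) (X.a t ω)

/-- The dynamic regret `R_T`. -/
def regret (X : Interaction d T Γ S k m Ω) (ω : Ω) : ℝ :=
  ∑ t ∈ Finset.Icc 1 T,
    (sSup ((fun x : Vec d => X.μ (inner ℝ x (X.θ t))) '' X.A t ω)
      - X.μ (inner ℝ (X.a t ω) (X.θ t)))

/-- The property `Q` holds on an event of probability at least `1 - δ`. -/
def WithHighProb (X : Interaction d T Γ S k m Ω) (δ : ℝ) (Q : Ω → Prop) : Prop :=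
  ∃ G : Set Ω, MeasurableSet G ∧ 1 - δ ≤ X.P.real G ∧ ∀ ω ∈ G, Q ω

end Interaction

/-- The factor `C₁`; it depends neither on `c_μ` nor on `γ`. -/
def C₁ (T : ℕ) (S k m lam : ℝ) : ℝ :=
  2 * m * Real.log T + 2 * k * (2 * S * k + m) / lam

/-- The factor `C₂`; it depends neither on `c_μ`, nor on `γ`, nor on `T`. -/
def C₂ (k lam : ℝ) : ℝ :=
  2 * Real.sqrt (2 * max 1 (k / lam) * max 1 k)

end DGLUCB

end

/-! Fix a round `t` without a recent parameter change, write θ for the true parameter θ*_t, and put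
Δ = θ̂_t − θ. The discount weights g_s = γ^(t-1-s) are split into v_s and g_s − v_s, where v
vanishes beyond a window of about log T/(1 − γ) rounds. Inside the window the parameter is θ, so the
v-part of the residuals is a weighted sum of genuine martingale noise. The rest has total weight at
most 1/(T(1 − γ)) and residuals of size at most m, which only enlarges S to S̄.

The noise is controlled by an exponential supermartingale whose variance terms are the slopes μ'.
Since rewards lie in [0, m], the Bernstein moment bound `lintegral_exp_centered_le` is available for
directions of norm at most 1/m. Averaging over a Gaussian truncated to that ball yields
`self_normalized_concentration`. Because v² ≤ g, its v²-weighted Hessian is dominated by the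
g-weighted one, so a single matrix suffices.

No projection is needed, because self-concordance bounds every secant slope from below by the slope
at the true parameter divided by 1 + |aᵀΔ|. Testing the score equation against Δ gives u ≤ 1 + S̄ +
(ρ/√λ)√u, where u = 1 + √(Y/λ) and Y is the secant quadratic form. The Hessian form of Δ is then at
most λu³, which explains the power 3/2 in the width (`confidence_of_self_normalized`). The constant
cμ is used only at true parameters, and costs 1/√cμ.

On rounds without a recent change, optimism and the elliptical potential with forgetting
(`sum_invNorm_le`) bound the regret. The at most Γ(D + 1) remaining rounds cost m each. At the tuned
γ, Γ/(1 − γ) equals the rate exactly, and when T(1 − γ) < 1 the trivial bound mT is already below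
the rate (`bound_le_rate`). -/

namespace DGLUCB

/-! ### Exponential families: cumulants and a Bernstein moment bound. -/

namespace RewardModel

variable {d : ℕ} {S k : ℝ} (M : RewardModel d S k)

lemma measurable_density (x : ℝ) : Measurable (density M.b M.c x) := by
  have := M.measurable_c
  unfold density
  fun_prop

instance isProbabilityMeasure_rewardLaw (x : ℝ) :
    IsProbabilityMeasure (rewardLaw M.ν M.b M.c x) := M.isProb x

/-- Densities are strictly positive, so all reward laws share their null sets. This transfers the
support [0, m] from one natural parameter to every other. -/
lemma absolutelyContinuous_rewardLaw (x y : ℝ) :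
    rewardLaw M.ν M.b M.c x ≪ rewardLaw M.ν M.b M.c y := by
  refine (withDensity_absolutelyContinuous _ _).trans ?_
  refine withDensity_absolutelyContinuous' (M.measurable_density y).ennreal_ofReal.aemeasurable ?_
  filter_upwards with r
  simp [density, Real.exp_pos]

lemma rewardLaw_eq_withDensity (x : ℝ) :
    rewardLaw M.ν M.b M.c x = (rewardLaw M.ν M.b M.c 0).withDensity
      fun r => ENNReal.ofReal (Real.exp (x * r) * Real.exp (M.b 0 - M.b x)) := by
  unfold rewardLaw
  rw [← withDensity_mul _ (M.measurable_density 0).ennreal_ofReal (by fun_prop)]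
  congr 1
  ext r
  simp only [density, Pi.mul_apply]
  rw [← ENNReal.ofReal_mul (Real.exp_pos _).le, ← Real.exp_add, ← Real.exp_add]
  congr 2
  ring

/-- Total mass one of the law at `x`, read against the law at 0, is precisely the value of the
moment generating function there. -/
lemma integrable_exp_mul (x : ℝ) :
    Integrable (fun r : ℝ => Real.exp (x * r)) (rewardLaw M.ν M.b M.c 0) ∧
      ∫ r, Real.exp (x * r) ∂(rewardLaw M.ν M.b M.c 0) = Real.exp (M.b x - M.b 0) := by
  have h1 : ∫⁻ r, ENNReal.ofReal (Real.exp (x * r) * Real.exp (M.b 0 - M.b x))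
      ∂(rewardLaw M.ν M.b M.c 0) = 1 := by
    have := (M.isProb x).measure_univ
    rw [M.rewardLaw_eq_withDensity x, withDensity_apply _ MeasurableSet.univ,
      Measure.restrict_univ] at this
    exact this
  have h2 : Integrable (fun r : ℝ => Real.exp (x * r) * Real.exp (M.b 0 - M.b x))
      (rewardLaw M.ν M.b M.c 0) := by
    refine ⟨by fun_prop, ?_⟩
    rw [hasFiniteIntegral_iff_ofReal (by filter_upwards with r; positivity), h1]
    simp
  have h3 : ∫ r, Real.exp (x * r) * Real.exp (M.b 0 - M.b x) ∂(rewardLaw M.ν M.b M.c 0) = 1 := by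
    rw [integral_eq_lintegral_of_nonneg_ae (by filter_upwards with r; positivity) h2.1, h1]
    simp
  constructor
  · have := h2.mul_const (Real.exp (M.b x - M.b 0))
    refine this.congr ?_
    filter_upwards with r
    rw [mul_assoc, ← Real.exp_add]
    simp
  · rw [integral_mul_const] at h3
    rw [← neg_sub, Real.exp_neg] at h3
    exact eq_of_mul_inv_eq_one h3

/-- Every law is an exponential tilt of the law at 0, so its mean and variance are the first two
derivatives of the cumulant generating function b − b(0). -/
lemma rewardLaw_eq_tilted (x : ℝ) :
    rewardLaw M.ν M.b M.c x = (rewardLaw M.ν M.b M.c 0).tilted (x * id ·) := by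
  rw [M.rewardLaw_eq_withDensity x, Measure.tilted]
  simp only [id, (M.integrable_exp_mul x).2]
  congr 1
  ext r
  rw [← neg_sub (M.b x), Real.exp_neg, div_eq_mul_inv]

lemma mem_interior_integrableExpSet (x : ℝ) :
    x ∈ interior (integrableExpSet id (rewardLaw M.ν M.b M.c 0)) := by
  have : integrableExpSet id (rewardLaw M.ν M.b M.c 0) = Set.univ :=
    Set.eq_univ_of_forall fun y => (M.integrable_exp_mul y).1
  simp [this]

lemma cgf_rewardLaw : cgf id (rewardLaw M.ν M.b M.c 0) = fun x => M.b x - M.b 0 := by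
  ext x
  simp only [cgf, mgf, id, (M.integrable_exp_mul x).2, Real.log_exp]

/-- The mean of the reward law is the mean function. -/
lemma integral_rewardLaw (x : ℝ) : ∫ r, r ∂(rewardLaw M.ν M.b M.c x) = M.μ x := by
  have := integral_tilted_mul_self (M.mem_interior_integrableExpSet x)
  rw [← M.rewardLaw_eq_tilted, M.cgf_rewardLaw] at this
  simpa [μ] using this

/-- The variance of the reward law is the derivative of the mean function. -/
lemma variance_rewardLaw (x : ℝ) :
    variance id (rewardLaw M.ν M.b M.c x) = deriv M.μ x := by
  have := variance_tilted_mul (M.mem_interior_integrableExpSet x)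
  rw [← M.rewardLaw_eq_tilted, M.cgf_rewardLaw] at this
  rw [this, iteratedDeriv_succ, iteratedDeriv_one]
  have h : deriv (fun x => M.b x - M.b 0) = M.μ := by
    ext y; simp [μ]
  rw [h]

lemma memLp_rewardLaw (x : ℝ) (p : NNReal) : MemLp id p (rewardLaw M.ν M.b M.c x) := by
  rw [M.rewardLaw_eq_tilted]
  exact memLp_tilted_mul (M.mem_interior_integrableExpSet x) p

lemma differentiable_μ : Differentiable ℝ M.μ := by
  have := M.contDiff_b
  have h : ContDiff ℝ 1 (deriv M.b) := by
    rw [show (2 : WithTop ℕ∞) = 1 + 1 from by norm_num, contDiff_succ_iff_deriv] at this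
    exact this.2.2
  exact h.differentiable (by norm_num)

lemma slope_nonneg (x : ℝ) : 0 ≤ deriv M.μ x := (abs_nonneg _).trans (M.selfConcordant x)

lemma slope_le (x : ℝ) : deriv M.μ x ≤ k := by
  have hk : 0 ≤ k := by
    have := M.lipschitz 0 1
    have h0 := abs_nonneg (deriv M.b 0 - deriv M.b 1)
    norm_num at this
    linarith
  have h : LipschitzWith ⟨k, hk⟩ M.μ := by
    refine LipschitzWith.of_dist_le_mul fun x y => ?_
    simpa [Real.dist_eq] using! M.lipschitz x y
  have := norm_deriv_le_of_lipschitz (x₀ := x) h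
  exact (le_abs_self _).trans this

lemma cμ_pos : 0 < M.cμ := M.minSlope_pos

lemma cμ_le_slope {θ a : Vec d} (hθ : ‖θ‖ ≤ S) (ha : ‖a‖ ≤ 1) :
    M.cμ ≤ deriv M.μ (inner ℝ a θ) := by
  refine csInf_le ⟨0, ?_⟩ ⟨θ, a, hθ, ha, rfl⟩
  rintro y ⟨θ, a, -, -, rfl⟩
  exact M.slope_nonneg _

lemma cμ_le (hS : 0 ≤ S) : M.cμ ≤ k := by
  have := M.cμ_le_slope (θ := 0) (a := 0) (by simpa) (by simp)
  exact this.trans (M.slope_le _)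

/-- A Bernstein-type bound on the moment generating function of the centred reward. -/
lemma lintegral_exp_centered_le {m : ℝ} (x y : ℝ)
    (hr : ∀ᵐ r ∂(rewardLaw M.ν M.b M.c x), 0 ≤ r ∧ r ≤ m) (hy : |y| * m ≤ 1) :
    ∫⁻ r, ENNReal.ofReal (Real.exp (y * (r - M.μ x) - y ^ 2 * deriv M.μ x))
      ∂(rewardLaw M.ν M.b M.c x) ≤ 1 := by
  set P := rewardLaw M.ν M.b M.c x
  have hL2 : MemLp id 2 P := by simpa using M.memLp_rewardLaw x 2
  have hint : Integrable (fun r : ℝ => r) P := hL2.integrable (by norm_num)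
  have hμ0 : 0 ≤ M.μ x := by
    rw [← M.integral_rewardLaw]
    exact integral_nonneg_of_ae (hr.mono fun r h => h.1)
  have hμm : M.μ x ≤ m := by
    rw [← M.integral_rewardLaw]
    calc ∫ r, r ∂P ≤ ∫ r, m ∂P := integral_mono_ae hint (integrable_const _) (hr.mono fun r h => h.2)
      _ = m := by simp
  have hsq : ∫ r, (r - M.μ x) ^ 2 ∂P = deriv M.μ x := by
    rw [← M.variance_rewardLaw, variance_eq_integral aemeasurable_id]
    simp only [id, M.integral_rewardLaw, P]
  have hL2' : Integrable (fun r => (r - M.μ x) ^ 2) P :=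
    (hL2.sub (memLp_const (M.μ x))).integrable_sq
  set f : ℝ → ℝ := fun r => 1 + y * (r - M.μ x) + y ^ 2 * (r - M.μ x) ^ 2
  have hf : Integrable f P :=
    ((integrable_const _).add ((hint.sub (integrable_const _)).const_mul y)).add
      (hL2'.const_mul (y ^ 2))
  have hfint : ∫ r, f r ∂P = 1 + y ^ 2 * deriv M.μ x := by
    have h1 : Integrable (fun r => y * (r - M.μ x)) P :=
      (hint.sub (integrable_const _)).const_mul y
    simp only [f]
    rw [integral_add (f := fun r => 1 + y * (r - M.μ x)) ((integrable_const _).add h1) (hL2'.const_mul _),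
      integral_add (integrable_const _) h1, integral_const_mul, integral_const_mul, hsq,
      integral_sub hint (integrable_const _), M.integral_rewardLaw]
    simp
  have hpt : ∀ᵐ r ∂P, Real.exp (y * (r - M.μ x) - y ^ 2 * deriv M.μ x)
      ≤ Real.exp (-(y ^ 2 * deriv M.μ x)) * f r := by
    filter_upwards [hr] with r h
    have hu : |y * (r - M.μ x)| ≤ 1 := by
      rw [abs_mul]
      refine le_trans (mul_le_mul_of_nonneg_left ?_ (abs_nonneg y)) hy
      rw [abs_le]; constructor <;> linarith
    -- For |u| ≤ 1, e^u ≤ 1 + u + u². After integration, 1 + y²μ' ≤ exp(y²μ') finishes.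
    have h3 := (abs_le.1 (Real.abs_exp_sub_one_sub_id_le hu)).2
    rw [sub_eq_add_neg, Real.exp_add, mul_comm]
    refine mul_le_mul_of_nonneg_left ?_ (Real.exp_pos _).le
    simp only [f]
    nlinarith
  calc _ ≤ ∫⁻ r, ENNReal.ofReal (Real.exp (-(y ^ 2 * deriv M.μ x)) * f r) ∂P :=
        lintegral_mono_ae (hpt.mono fun r h => ENNReal.ofReal_le_ofReal h)
    _ = ENNReal.ofReal (∫ r, Real.exp (-(y ^ 2 * deriv M.μ x)) * f r ∂P) := by
        rw [ofReal_integral_eq_lintegral_ofReal (hf.const_mul _)]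
        exact hpt.mono fun r h => (Real.exp_pos _).le.trans h
    _ ≤ 1 := by
        rw [integral_const_mul, hfint, ← ENNReal.ofReal_one]
        refine ENNReal.ofReal_le_ofReal ?_
        rw [Real.exp_neg, inv_mul_le_iff₀ (Real.exp_pos _), mul_one, add_comm]
        exact Real.add_one_le_exp _

/-- The reward laws as a Markov kernel. -/
noncomputable def rewardKernel : Kernel ℝ ℝ :=
  (Kernel.const ℝ (rewardLaw M.ν M.b M.c 0)).withDensity
    fun x r => ENNReal.ofReal (Real.exp (x * r) * Real.exp (M.b 0 - M.b x))

lemma rewardKernel_apply (x : ℝ) : M.rewardKernel x = rewardLaw M.ν M.b M.c x := by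
  have hb := M.contDiff_b.continuous.measurable
  rw [rewardKernel, Kernel.withDensity_apply _ (by fun_prop), Kernel.const_apply,
    M.rewardLaw_eq_withDensity x]

instance : IsMarkovKernel M.rewardKernel :=
  ⟨fun x => by rw [M.rewardKernel_apply]; infer_instance⟩

end RewardModel

/-! ### Self-concordance: secant slopes against tangent slopes. -/

/-- Monotonicity form of generalized self-concordance. -/
lemma self_concordant_lower_of_nonneg {f : ℝ → ℝ} (hf : Differentiable ℝ f)
    (hf' : Differentiable ℝ (deriv f)) (hsc : ∀ x, |deriv (deriv f) x| ≤ deriv f x)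
    (x : ℝ) {z : ℝ} (hz : 0 ≤ z) :
    deriv f x * z ≤ (1 + z) * (f (x + z) - f x) := by
  -- e^y f'(x + y) is nondecreasing because f'' ≥ −f'.
  have hexp : ∀ y, 0 ≤ y → deriv f x ≤ Real.exp y * deriv f (x + y) := by
    have hd : ∀ y, HasDerivAt (fun y => Real.exp y * deriv f (x + y))
        (Real.exp y * deriv f (x + y) + Real.exp y * deriv (deriv f) (x + y)) y := fun y => by
      have h2 : HasDerivAt (fun y => deriv f (x + y)) (deriv (deriv f) (x + y)) y :=
        (hf' (x + y)).hasDerivAt.comp_const_add x y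
      exact (Real.hasDerivAt_exp y).mul h2
    have hm : Monotone fun y => Real.exp y * deriv f (x + y) := by
      refine monotone_of_deriv_nonneg (fun y => (hd y).differentiableAt) fun y => ?_
      rw [(hd y).deriv, ← mul_add]
      have := (abs_le.1 (hsc (x + y))).1
      exact mul_nonneg (Real.exp_pos _).le (by linarith)
    intro y hy
    simpa using hm hy
  have hg : ∀ y, HasDerivAt (fun y => f (x + y) + deriv f x * Real.exp (-y))
      (deriv f (x + y) - deriv f x * Real.exp (-y)) y := fun y => by
    have h1 : HasDerivAt (fun y => f (x + y)) (deriv f (x + y)) y :=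
      (hf (x + y)).hasDerivAt.comp_const_add x y
    have h2 : HasDerivAt (fun y : ℝ => Real.exp (-y)) (Real.exp (-y) * (-1)) y :=
      (hasDerivAt_neg y).exp
    exact (h1.add (h2.const_mul (deriv f x))).congr_deriv (by ring)
  have hmono : MonotoneOn (fun y => f (x + y) + deriv f x * Real.exp (-y)) (Set.Ici 0) := by
    refine monotoneOn_of_deriv_nonneg (convex_Ici 0)
      (fun y _ => (hg y).continuousAt.continuousWithinAt)
      (fun y _ => (hg y).differentiableAt.differentiableWithinAt) fun y hy => ?_
    rw [interior_Ici, Set.mem_Ioi] at hy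
    rw [(hg y).deriv, sub_nonneg, Real.exp_neg, ← div_eq_mul_inv, div_le_iff₀ (Real.exp_pos _),
      mul_comm]
    exact hexp y hy.le
  have h := hmono (Set.mem_Ici.2 le_rfl) (Set.mem_Ici.2 hz) hz
  simp only [add_zero, neg_zero, Real.exp_zero, mul_one] at h
  -- The increment of f is at least f'(x)(1 − e^(-z)), and 1 − e^(-z) ≥ z/(1 + z).
  have hE : (1 + z) * Real.exp (-z) ≤ 1 := by
    rw [Real.exp_neg, ← div_eq_mul_inv, div_le_one (Real.exp_pos _), add_comm]
    exact Real.add_one_le_exp z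
  have h0 : 0 ≤ deriv f x := (abs_nonneg _).trans (hsc x)
  nlinarith

/-- Generalized self-concordance bounds secant slopes from below by the tangent slope. -/
lemma self_concordant_lower {f : ℝ → ℝ} (hf : Differentiable ℝ f)
    (hf' : Differentiable ℝ (deriv f)) (hsc : ∀ x, |deriv (deriv f) x| ≤ deriv f x)
    (x y : ℝ) :
    deriv f x * (y - x) ^ 2 ≤ (1 + |y - x|) * ((f y - f x) * (y - x)) := by
  rcases le_total x y with h | h
  · have := self_concordant_lower_of_nonneg hf hf' hsc x (sub_nonneg.2 h)
    rw [add_sub_cancel] at this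
    rw [abs_of_nonneg (sub_nonneg.2 h)]
    nlinarith [mul_le_mul_of_nonneg_right this (sub_nonneg.2 h)]
  -- The reflection −f(−x) is again self-concordant and turns a negative displacement into a
  -- positive one.
  · set g : ℝ → ℝ := fun x => -f (-x)
    have hd : deriv g = fun x => deriv f (-x) := by
      ext x; simp [g, deriv_comp_neg]
    have hd2 : deriv (deriv g) = fun x => -deriv (deriv f) (-x) := by
      rw [hd]; ext x; rw [deriv_comp_neg]
    have := self_concordant_lower_of_nonneg (f := g) (by fun_prop) (by rw [hd]; fun_prop)
      (by rw [hd2, hd]; intro x; simpa using hsc (-x)) (-x) (z := x - y) (sub_nonneg.2 h)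
    rw [hd] at this
    simp only [g, neg_neg, show -x + (x - y) = -y by ring] at this
    rw [abs_of_nonpos (sub_nonpos.2 h)]
    nlinarith [mul_le_mul_of_nonneg_right this (sub_nonneg.2 h)]

/-! ### Integration against a conditional law. -/

/-- Disintegration along a conditional law given through conditional probabilities of events. -/
lemma lintegral_mul_comp_of_condLaw {Ω E : Type*} {𝒢 mΩ : MeasurableSpace Ω} [MeasurableSpace E]
    {P : Measure Ω} [IsProbabilityMeasure P] (h𝒢 : 𝒢 ≤ mΩ)
    {κ : Kernel E ℝ} [IsMarkovKernel κ] {r : Ω → ℝ} (hr : Measurable r)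
    {Z : Ω → E} (hZ : Measurable[𝒢] Z)
    (hcond : ∀ B : Set ℝ, MeasurableSet B →
      P[(r ⁻¹' B).indicator (fun _ => (1 : ℝ)) | 𝒢] =ᵐ[P] fun ω => (κ (Z ω)).real B)
    {G : Ω → ENNReal} (hG : Measurable[𝒢] G) (hGfin : ∫⁻ ω, G ω ∂P ≠ ⊤)
    {f : E × ℝ → ENNReal} (hf : Measurable f) :
    ∫⁻ ω, G ω * f (Z ω, r ω) ∂P = ∫⁻ ω, G ω * ∫⁻ x, f (Z ω, x) ∂(κ (Z ω)) ∂P := by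
  have hZ' : Measurable Z := hZ.mono h𝒢 le_rfl
  have hG' : Measurable G := hG.mono h𝒢 le_rfl
  have hκ : ∀ B : Set ℝ, MeasurableSet B → Measurable[𝒢] fun ω => κ (Z ω) B := fun B hB =>
    (κ.measurable_coe hB).comp hZ
  have hset : ∀ B : Set ℝ, MeasurableSet B → ∀ F : Set Ω, MeasurableSet[𝒢] F →
      P (F ∩ r ⁻¹' B) = ∫⁻ ω in F, κ (Z ω) B ∂P := by
    intro B hB F hF
    have h1 := setIntegral_condExp (μ := P) h𝒢
      (f := (r ⁻¹' B).indicator (fun _ => (1 : ℝ)))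
      ((integrable_const 1).indicator (hr hB)) hF
    rw [setIntegral_congr_ae (h𝒢 F hF) ((hcond B hB).mono fun ω h _ => h),
      integral_indicator_const _ (hr hB)] at h1
    simp only [Measure.real, smul_eq_mul, mul_one] at h1
    rw [integral_toReal ((hκ B hB).mono h𝒢 le_rfl).aemeasurable
      (by filter_upwards with ω; exact measure_lt_top _ _)] at h1
    rw [Measure.restrict_apply (hr hB), Set.inter_comm] at h1
    refine ((ENNReal.toReal_eq_toReal_iff' ?_ (measure_ne_top _ _)).1 h1).symm
    refine ne_of_lt (lt_of_le_of_lt (lintegral_mono fun ω => prob_le_one) ?_)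
    simp
  -- For 𝒢-measurable integrands it is enough to compare the two measures on 𝒢, where `hset`
  -- identifies them.
  have hfun : ∀ B : Set ℝ, MeasurableSet B → ∀ g : Ω → ENNReal, Measurable[𝒢] g →
      ∫⁻ ω in r ⁻¹' B, g ω ∂P = ∫⁻ ω, κ (Z ω) B * g ω ∂P := by
    intro B hB g hg
    have hg' : Measurable g := hg.mono h𝒢 le_rfl
    have htrim : (P.restrict (r ⁻¹' B)).trim h𝒢
        = (P.withDensity fun ω => κ (Z ω) B).trim h𝒢 := by
      refine @Measure.ext Ω 𝒢 _ _ fun F hF => ?_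
      rw [trim_measurableSet_eq h𝒢 hF, trim_measurableSet_eq h𝒢 hF,
        Measure.restrict_apply (h𝒢 F hF), withDensity_apply _ (h𝒢 F hF), hset B hB F hF]
    rw [← lintegral_trim h𝒢 hg, htrim, lintegral_trim h𝒢 hg,
      lintegral_withDensity_eq_lintegral_mul _ ((hκ B hB).mono h𝒢 le_rfl) hg']
    rfl
  -- Absorbing the weight into a finite measure reduces the claim to an equality of joint laws,
  -- checked on rectangles.
  set Q := P.withDensity G with hQ
  have : IsFiniteMeasure Q := isFiniteMeasure_withDensity hGfin
  have hmeas : Q.map (fun ω => (Z ω, r ω)) = (Q.map Z) ⊗ₘ κ := by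
    refine Measure.ext_prod fun {A B} hA hB => ?_
    rw [Measure.map_apply (hZ'.prodMk hr) (hA.prod hB), Measure.compProd_apply_prod hA hB,
      setLIntegral_map hA (κ.measurable_coe hB) hZ']
    have e1 : (fun ω => (Z ω, r ω)) ⁻¹' (A ×ˢ B) = Z ⁻¹' A ∩ r ⁻¹' B := by
      ext; simp
    have hA' : MeasurableSet[𝒢] (Z ⁻¹' A) := hZ hA
    have hAm := h𝒢 _ hA'
    rw [e1, hQ, withDensity_apply _ (hAm.inter (hr hB)), ← Measure.restrict_restrict hAm,
      ← lintegral_indicator hAm, hfun B hB _ (hG.indicator hA'),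
      restrict_withDensity hAm, lintegral_withDensity_eq_lintegral_mul _ hG'
        ((hκ B hB).mono h𝒢 le_rfl), ← lintegral_indicator hAm]
    refine lintegral_congr fun ω => ?_
    by_cases hω : ω ∈ Z ⁻¹' A <;> simp [hω, mul_comm]
  have h1 : ∫⁻ ω, G ω * f (Z ω, r ω) ∂P = ∫⁻ z, f z ∂(Q.map (fun ω => (Z ω, r ω))) := by
    rw [lintegral_map hf (hZ'.prodMk hr)]
    exact (lintegral_withDensity_eq_lintegral_mul _ hG' (hf.comp (hZ'.prodMk hr))).symm
  rw [h1, hmeas, Measure.lintegral_compProd hf, lintegral_map hf.lintegral_kernel_prod_right' hZ']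
  exact lintegral_withDensity_eq_lintegral_mul _ hG'
    ((hf.lintegral_kernel_prod_right' (κ := κ)).comp hZ')

/-! ### The exponential supermartingale of the weighted noise. -/

namespace Interaction

variable {d T Γ : ℕ} {S k m : ℝ} {Ω : Type*} [MeasurableSpace Ω] (X : Interaction d T Γ S k m Ω)

instance : IsProbabilityMeasure X.P := X.isProbP

/-- All the reward laws are carried by `[0, m]`. -/
lemma ae_rewardLaw_mem (hT : 1 ≤ T) (x : ℝ) :
    ∀ᵐ r ∂(rewardLaw X.ν X.b X.c x), 0 ≤ r ∧ r ≤ m := by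
  have h1 := X.cond_law 1 le_rfl hT (Set.Icc 0 m) measurableSet_Icc
  have h2 : (X.r (1 + 1) ⁻¹' Set.Icc 0 m).indicator (fun _ => (1 : ℝ)) =ᵐ[X.P] fun _ => 1 := by
    filter_upwards [X.r_bounded 1 le_rfl hT] with ω hω
    exact Set.indicator_of_mem (by exact hω) _
  have h3 := (condExp_congr_ae (m := X.ℱ 1) h2).symm.trans h1
  rw [condExp_const (X.ℱ.le 1)] at h3
  -- One outcome suffices: the law at its natural parameter gives [0, m] full mass, and all reward
  -- laws have the same null sets.
  obtain ⟨ω, hω⟩ := h3.exists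
  set y : ℝ := inner ℝ (X.a 1 ω) (X.θ 1)
  have hy : ∀ᵐ r ∂(rewardLaw X.ν X.b X.c y), r ∈ Set.Icc 0 m := by
    have := X.isProb y
    refine (prob_compl_eq_zero_iff measurableSet_Icc).2 ?_
    rw [← ENNReal.toReal_eq_one_iff]
    exact hω.symm
  exact (X.toRewardModel.absolutelyContinuous_rewardLaw x y).ae_le hy

lemma μ_mem_Icc (hT : 1 ≤ T) (x : ℝ) : X.μ x ∈ Set.Icc 0 m := by
  have hr := X.ae_rewardLaw_mem hT x
  have hP := X.isProb x
  have hint : Integrable (fun r : ℝ => r) (rewardLaw X.ν X.b X.c x) := by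
    have := X.toRewardModel.memLp_rewardLaw x 1
    exact this.integrable (by simp)
  rw [← X.toRewardModel.integral_rewardLaw]
  refine ⟨integral_nonneg_of_ae (hr.mono fun r h => h.1), ?_⟩
  calc ∫ r, r ∂(rewardLaw X.ν X.b X.c x) ≤ ∫ r, m ∂(rewardLaw X.ν X.b X.c x) :=
        integral_mono_ae hint (integrable_const _) (hr.mono fun r h => h.2)
    _ = m := by simp

lemma radius_nonneg (X : Interaction d T Γ S k m Ω) (hT : 1 ≤ T) : 0 ≤ S := (norm_nonneg _).trans (X.norm_θ_le 1 le_rfl hT)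

/-- The natural parameter of the reward of round `s`. -/
noncomputable def param (s : ℕ) (ω : Ω) : ℝ := inner ℝ (X.a s ω) (X.θ s)

/-- The reward noise of round `s`. -/
noncomputable def noise (s : ℕ) (ω : Ω) : ℝ := X.r (s + 1) ω - X.μ (X.param s ω)

lemma norm_a_le {s : ℕ} (h1 : 1 ≤ s) (h2 : s ≤ T) (ω : Ω) : ‖X.a s ω‖ ≤ 1 :=
  X.norm_action_le s h1 h2 ω _ (X.a_mem s h1 h2 ω)

lemma measurable_slope : Measurable (deriv X.μ) := measurable_deriv _

lemma measurable_param {s : ℕ} (h1 : 1 ≤ s) (h2 : s ≤ T) : Measurable[X.ℱ s] (X.param s) :=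
  (measurable_id.inner_const (c := X.θ s)).comp (X.measurable_a s h1 h2)

lemma measurable_noise {s : ℕ} (h1 : 1 ≤ s) (h2 : s ≤ T) :
    Measurable[X.ℱ (s + 1)] (X.noise s) :=
  Measurable.sub (X.measurable_r s h1 h2) (X.toRewardModel.differentiable_μ.continuous.measurable.comp
    ((X.measurable_param h1 h2).mono (X.ℱ.mono (Nat.le_succ s)) le_rfl))

/-- The log-increments of the exponential supermartingale in direction `ξ` with weights `v`. -/
noncomputable def logIncrement (v : ℕ → ℝ) (ξ : Vec d) (s : ℕ) (ω : Ω) : ℝ :=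
  (v s * inner ℝ (X.a s ω) ξ) * X.noise s ω
    - (v s * inner ℝ (X.a s ω) ξ) ^ 2 * deriv X.μ (X.param s ω)

lemma measurable_logIncrement (v : ℕ → ℝ) (ξ : Vec d) {s : ℕ} (h1 : 1 ≤ s) (h2 : s ≤ T) :
    Measurable[X.ℱ (s + 1)] (X.logIncrement v ξ s) := by
  have hle : X.ℱ s ≤ X.ℱ (s + 1) := X.ℱ.mono (Nat.le_succ s)
  have ha : Measurable[X.ℱ (s + 1)] (X.a s) := (X.measurable_a s h1 h2).mono hle le_rfl
  have hp := X.measurable_slope.comp ((X.measurable_param h1 h2).mono hle le_rfl)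
  have hn := X.measurable_noise h1 h2
  have hy : Measurable[X.ℱ (s + 1)] fun ω => v s * inner ℝ (X.a s ω) ξ :=
    ((measurable_id.inner_const (c := ξ)).const_mul (v s)).comp ha
  exact (hy.mul hn).sub ((hy.pow_const 2).mul hp)

/-- Given the past, the factor of the new round has mean at most one: |v_s| ≤ 1, ‖a_s‖ ≤ 1 and ‖ξ‖ ≤
1/m put its exponent in the range of the Bernstein bound. -/
lemma lintegral_exp_sum_logIncrement_le (hm : 0 < m) {v : ℕ → ℝ} (hv : ∀ s, |v s| ≤ 1) {ξ : Vec d}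
    (hξ : ‖ξ‖ ≤ 1 / m) (n : ℕ) (hn : n ≤ T) :
    ∫⁻ ω, ENNReal.ofReal (Real.exp (∑ s ∈ Finset.Ico 1 (n + 1), X.logIncrement v ξ s ω)) ∂X.P
      ≤ 1 := by
  induction n with
  | zero => simp
  | succ n ih =>
    have h1 : 1 ≤ n + 1 := Nat.le_add_left 1 n
    specialize ih (by omega)
    set κ : Kernel (ℝ × ℝ) ℝ := X.toRewardModel.rewardKernel.comap Prod.snd measurable_snd
    set y : Ω → ℝ := fun ω => v (n + 1) * inner ℝ (X.a (n + 1) ω) ξ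
    have hyb : ∀ ω, |y ω| * m ≤ 1 := fun ω => by
      have hin : |inner ℝ (X.a (n + 1) ω) ξ| ≤ 1 / m := by
        refine (abs_real_inner_le_norm _ _).trans ?_
        calc _ ≤ 1 * (1 / m) := mul_le_mul (X.norm_a_le h1 hn ω) hξ (norm_nonneg _) zero_le_one
          _ = 1 / m := one_mul _
      have : |y ω| ≤ 1 / m := by
        simp only [y, abs_mul]
        calc _ ≤ 1 * (1 / m) := mul_le_mul (hv _) hin (abs_nonneg _) zero_le_one
          _ = 1 / m := one_mul _
      rwa [le_div_iff₀ hm] at this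
    set Z : Ω → ℝ × ℝ := fun ω => (y ω, X.param (n + 1) ω)
    have hZ : Measurable[X.ℱ (n + 1)] Z := by
      have ha := X.measurable_a (n + 1) h1 hn
      have hp := X.measurable_param h1 hn
      exact (((measurable_id.inner_const (c := ξ)).const_mul (v (n + 1))).comp ha).prodMk hp
    set G : Ω → ENNReal := fun ω =>
      ENNReal.ofReal (Real.exp (∑ s ∈ Finset.Ico 1 (n + 1), X.logIncrement v ξ s ω))
    have hG : Measurable[X.ℱ (n + 1)] G := by
      have : ∀ s ∈ Finset.Ico 1 (n + 1), Measurable[X.ℱ (n + 1)] (X.logIncrement v ξ s) := by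
        intro s hs
        rw [Finset.mem_Ico] at hs
        exact (X.measurable_logIncrement v ξ hs.1 (by omega)).mono (X.ℱ.mono (by omega)) le_rfl
      exact (Finset.measurable_fun_sum _ this).exp.ennreal_ofReal
    set f : (ℝ × ℝ) × ℝ → ENNReal := fun z =>
      ENNReal.ofReal (Real.exp (z.1.1 * (z.2 - X.μ z.1.2) - z.1.1 ^ 2 * deriv X.μ z.1.2))
    have hf : Measurable f := by
      have h1 := X.measurable_slope
      have h2 := X.toRewardModel.differentiable_μ.continuous.measurable
      fun_prop
    have hκ : ∀ z, κ z = rewardLaw X.ν X.b X.c z.2 := fun z => by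
      simp only [κ, Kernel.comap_apply, RewardModel.rewardKernel_apply]
    -- The induction hypothesis also supplies the finiteness of the weight `G`.
    have hstep := lintegral_mul_comp_of_condLaw (P := X.P) (X.ℱ.le (n + 1)) (κ := κ)
      (r := X.r (n + 1 + 1)) ((X.measurable_r (n + 1) h1 hn).mono (X.ℱ.le _) le_rfl) hZ
      (fun B hB => by
        simp only [hκ]
        exact X.cond_law (n + 1) h1 hn B hB)
      hG (ne_top_of_le_ne_top ENNReal.one_ne_top ih) hf
    calc _ = ∫⁻ ω, G ω * f (Z ω, X.r (n + 1 + 1) ω) ∂X.P := by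
          refine lintegral_congr fun ω => ?_
          rw [Finset.sum_Ico_succ_top h1, Real.exp_add, ENNReal.ofReal_mul (Real.exp_pos _).le]
          rfl
      _ = _ := hstep
      _ ≤ ∫⁻ ω, G ω * 1 ∂X.P := by
          refine lintegral_mono fun ω => mul_le_mul_right ?_ _
          rw [hκ]
          exact X.toRewardModel.lintegral_exp_centered_le _ _
            (X.ae_rewardLaw_mem (h1.trans hn) _) (hyb ω)
      _ ≤ 1 := by simpa using ih

end Interaction

/-! ### Weighted Gram matrices: determinants, traces and dual norms. -/

section Gram

variable {d : ℕ}

/-- The weighted Gram matrix `∑ w_s a_s a_sᵀ`. -/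
def gram (I : Finset ℕ) (w : ℕ → ℝ) (a : ℕ → Vec d) : Matrix (Fin d) (Fin d) ℝ :=
  ∑ s ∈ I, w s • Matrix.vecMulVec (a s).ofLp (a s).ofLp

lemma inner_eq_dotProduct (x y : Vec d) : inner ℝ x y = x.ofLp ⬝ᵥ y.ofLp := by
  rw [EuclideanSpace.inner_eq_star_dotProduct, star_trivial, dotProduct_comm]

lemma dotProduct_self_eq_norm_sq (x : Vec d) : x.ofLp ⬝ᵥ x.ofLp = ‖x‖ ^ 2 := by
  rw [← inner_eq_dotProduct, real_inner_self_eq_norm_sq]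

lemma quad_gram (I : Finset ℕ) (w : ℕ → ℝ) (a : ℕ → Vec d) (x : Vec d) :
    x.ofLp ⬝ᵥ (gram I w a *ᵥ x.ofLp) = ∑ s ∈ I, w s * (inner ℝ (a s) x) ^ 2 := by
  rw [gram, Matrix.sum_mulVec, dotProduct_sum]
  refine Finset.sum_congr rfl fun s _ => ?_
  rw [Matrix.smul_mulVec, dotProduct_smul, Matrix.vecMulVec_mulVec, inner_eq_dotProduct]
  simp only [op_smul_eq_smul, dotProduct_smul, smul_eq_mul]
  rw [dotProduct_comm x.ofLp]
  ring

lemma posSemidef_vecMulVec (a : Fin d → ℝ) : (Matrix.vecMulVec a a).PosSemidef := by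
  simpa using Matrix.posSemidef_vecMulVec_self_star a

lemma posSemidef_gram (I : Finset ℕ) (w : ℕ → ℝ) (hw : ∀ s ∈ I, 0 ≤ w s) (a : ℕ → Vec d) :
    (gram I w a).PosSemidef :=
  Matrix.posSemidef_sum _ fun s hs => (posSemidef_vecMulVec _).smul (hw s hs)

lemma trace_gram (I : Finset ℕ) (w : ℕ → ℝ) (a : ℕ → Vec d) :
    (gram I w a).trace = ∑ s ∈ I, w s * ‖a s‖ ^ 2 := by
  rw [gram, Matrix.trace_sum]
  refine Finset.sum_congr rfl fun s _ => ?_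
  rw [Matrix.trace_smul, Matrix.trace_vecMulVec, dotProduct_self_eq_norm_sq, smul_eq_mul]

lemma posDef_add_smul_one {A : Matrix (Fin d) (Fin d) ℝ} (hA : A.PosSemidef) {l : ℝ} (hl : 0 < l) :
    (A + l • (1 : Matrix (Fin d) (Fin d) ℝ)).PosDef :=
  Matrix.PosDef.posSemidef_add hA (Matrix.PosDef.one.smul hl)

lemma quad_add_smul_one (A : Matrix (Fin d) (Fin d) ℝ) (l : ℝ) (x : Vec d) :
    x.ofLp ⬝ᵥ ((A + l • (1 : Matrix (Fin d) (Fin d) ℝ)) *ᵥ x.ofLp)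
      = x.ofLp ⬝ᵥ (A *ᵥ x.ofLp) + l * ‖x‖ ^ 2 := by
  rw [Matrix.add_mulVec, dotProduct_add, Matrix.smul_mulVec, Matrix.one_mulVec, dotProduct_smul,
    dotProduct_self_eq_norm_sq, smul_eq_mul]

/-- The determinant-trace inequality. -/
lemma det_le_pow_trace (hd : 1 ≤ d) {A : Matrix (Fin d) (Fin d) ℝ} (hA : A.PosSemidef) :
    A.det ≤ (A.trace / d) ^ d := by
  have h0 := hA.eigenvalues_nonneg
  have hdet : A.det = ∏ i, hA.1.eigenvalues i := by
    simpa using hA.1.det_eq_prod_eigenvalues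
  have htr : A.trace = ∑ i, hA.1.eigenvalues i := by
    simpa using hA.1.trace_eq_sum_eigenvalues
  have hd0 : (0 : ℝ) < d := by exact_mod_cast hd
  have h := Real.geom_mean_le_arith_mean Finset.univ (fun _ => 1) hA.1.eigenvalues
    (fun _ _ => zero_le_one) (by simpa using hd0) (fun i _ => h0 i)
  simp only [Real.rpow_one, one_mul, Finset.sum_const, Finset.card_univ, Fintype.card_fin,
    nsmul_eq_mul, mul_one] at h
  rw [← hdet, ← htr] at h
  have hnn := hA.det_nonneg
  calc A.det = (A.det ^ ((d : ℝ)⁻¹)) ^ d := by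
        rw [← Real.rpow_natCast, ← Real.rpow_mul hnn, inv_mul_cancel₀ hd0.ne', Real.rpow_one]
    _ ≤ _ := pow_le_pow_left₀ (Real.rpow_nonneg hnn _) h d

lemma log_det_add_smul_one_le (hd : 1 ≤ d) {A : Matrix (Fin d) (Fin d) ℝ} (hA : A.PosSemidef)
    {l τ : ℝ} (hl : 0 < l) (hτ : A.trace ≤ τ) :
    Real.log ((A + l • (1 : Matrix (Fin d) (Fin d) ℝ)).det) - d * Real.log l
      ≤ d * Real.log (1 + τ / (d * l)) := by
  have hd0 : (0 : ℝ) < d := by exact_mod_cast hd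
  have hP := posDef_add_smul_one hA hl
  have h := det_le_pow_trace hd hP.posSemidef
  rw [Matrix.trace_add, Matrix.trace_smul, Matrix.trace_one, Fintype.card_fin, smul_eq_mul] at h
  have hτ0 : 0 ≤ τ := hA.trace_nonneg.trans hτ
  have h2 : (A.trace + l * d) / d ≤ l * (1 + τ / (d * l)) := by
    rw [div_le_iff₀ hd0]
    have : l * (1 + τ / (d * l)) * d = l * d + τ := by field_simp
    rw [this]; linarith
  have h3 : (A + l • (1 : Matrix (Fin d) (Fin d) ℝ)).det ≤ (l * (1 + τ / (d * l))) ^ d :=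
    h.trans (pow_le_pow_left₀ (div_nonneg (add_nonneg hA.trace_nonneg (by positivity)) hd0.le) h2 d)
  have h4 := Real.log_le_log hP.det_pos h3
  rw [Real.log_pow, Real.log_mul hl.ne' (by positivity)] at h4
  linarith

lemma det_add_smul_vecMulVec {A : Matrix (Fin d) (Fin d) ℝ} (hA : A.PosDef) (c : ℝ)
    (a : Fin d → ℝ) :
    (A + c • Matrix.vecMulVec a a).det = A.det * (1 + c * (a ⬝ᵥ (A⁻¹ *ᵥ a))) := by
  rw [← Matrix.smul_vecMulVec, Matrix.vecMulVec_eq Unit,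
    Matrix.det_add_replicateCol_mul_replicateRow (isUnit_iff_ne_zero.2 hA.det_pos.ne')]
  congr 1
  rw [Matrix.det_unique, Matrix.add_apply, Matrix.one_apply_eq, Matrix.mul_assoc,
    ← Matrix.replicateCol_mulVec, Matrix.replicateRow_mul_replicateCol_apply, Matrix.mulVec_smul,
    dotProduct_smul, smul_eq_mul]

/-- c·I is a sum of rank-one updates along the coordinate axes, and by the matrix determinant lemma
none of them decreases the determinant. -/
lemma det_le_det_add_smul_one {A : Matrix (Fin d) (Fin d) ℝ} (hA : A.PosDef) {c : ℝ} (hc : 0 ≤ c) :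
    A.det ≤ (A + c • (1 : Matrix (Fin d) (Fin d) ℝ)).det := by
  have key : ∀ s : Finset (Fin d),
      (A + ∑ i ∈ s, c • Matrix.vecMulVec (Pi.single i (1 : ℝ)) (Pi.single i 1)).PosDef ∧
      A.det ≤ (A + ∑ i ∈ s, c • Matrix.vecMulVec (Pi.single i (1 : ℝ)) (Pi.single i 1)).det := by
    intro s
    induction s using Finset.induction_on with
    | empty => simpa using hA
    | insert i s hi ih =>
      rw [Finset.sum_insert hi, add_comm (c • _), ← add_assoc]
      refine ⟨ih.1.add_posSemidef ((posSemidef_vecMulVec _).smul hc), ih.2.trans ?_⟩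
      rw [det_add_smul_vecMulVec ih.1]
      have := ih.1.inv.posSemidef.dotProduct_mulVec_nonneg (Pi.single i 1)
      rw [star_trivial] at this
      exact le_mul_of_one_le_right ih.1.det_pos.le (by nlinarith [mul_nonneg hc this])
  have h1 : c • (1 : Matrix (Fin d) (Fin d) ℝ)
      = ∑ i, c • Matrix.vecMulVec (Pi.single i (1 : ℝ)) (Pi.single i 1) := by
    rw [← Finset.smul_sum]
    congr 1
    ext i j
    simp [Matrix.sum_apply, Matrix.vecMulVec_apply, Pi.single_apply, Matrix.one_apply]
  rw [h1]
  exact (key Finset.univ).2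

/-- Cauchy-Schwarz for the dual norms `‖·‖_{V⁻¹}` and `‖·‖_V`. -/
lemma abs_inner_le_invNorm_mul {V : Matrix (Fin d) (Fin d) ℝ} (hV : V.PosDef) (x y : Vec d) :
    |inner ℝ x y| ≤ invNorm V x * Real.sqrt (y.ofLp ⬝ᵥ (V *ᵥ y.ofLp)) := by
  set u := x.ofLp
  set w := y.ofLp
  have hdet : IsUnit V.det := isUnit_iff_ne_zero.2 hV.det_pos.ne'
  have hsymm : Vᵀ = V := by simpa using hV.1.eq
  have hA : 0 ≤ u ⬝ᵥ (V⁻¹ *ᵥ u) := by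
    simpa using hV.inv.posSemidef.dotProduct_mulVec_nonneg u
  have hB : 0 ≤ w ⬝ᵥ (V *ᵥ w) := by simpa using hV.posSemidef.dotProduct_mulVec_nonneg w
  have hVV : V *ᵥ (V⁻¹ *ᵥ u) = u := by
    rw [Matrix.mulVec_mulVec, Matrix.mul_nonsing_inv _ hdet, Matrix.one_mulVec]
  have hcross : (V⁻¹ *ᵥ u) ⬝ᵥ (V *ᵥ w) = u ⬝ᵥ w := by
    rw [Matrix.dotProduct_mulVec, ← Matrix.mulVec_transpose, hsymm, hVV]
  -- The squared V-norm of tV⁻¹u + w is a nonnegative quadratic polynomial in t.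
  have hdisc : discrim (u ⬝ᵥ (V⁻¹ *ᵥ u)) (2 * (u ⬝ᵥ w)) (w ⬝ᵥ (V *ᵥ w)) ≤ 0 := by
    refine discrim_le_zero fun t => ?_
    have := hV.posSemidef.dotProduct_mulVec_nonneg (t • (V⁻¹ *ᵥ u) + w)
    rw [star_trivial, Matrix.mulVec_add, Matrix.mulVec_smul, hVV] at this
    simp only [add_dotProduct, dotProduct_add, smul_dotProduct, dotProduct_smul, smul_eq_mul,
      hcross, dotProduct_comm (V⁻¹ *ᵥ u) u, dotProduct_comm w u] at this
    linarith
  rw [inner_eq_dotProduct, invNorm, ← Real.sqrt_mul hA]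
  refine Real.abs_le_sqrt ?_
  rw [discrim] at hdisc
  nlinarith

lemma exists_conjTranspose_mul_self {A : Matrix (Fin d) (Fin d) ℝ} (hA : A.PosSemidef) :
    ∃ B : Matrix (Fin d) (Fin d) ℝ, A = Bᵀ * B := by
  open scoped MatrixOrder in
  obtain ⟨B, hB⟩ := CStarAlgebra.nonneg_iff_eq_star_mul_self.mp hA.nonneg
  exact ⟨B, by simpa [Matrix.star_eq_conjTranspose] using hB⟩

end Gram

/-! ### Truncated Gaussian mixtures. -/

section Mixture

variable {d : ℕ}

lemma lintegral_comp_linear {f : Vec d → ENNReal} (hf : Measurable f) (L : Vec d →ₗ[ℝ] Vec d)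
    (hL : LinearMap.det L ≠ 0) (x0 : Vec d) :
    ∫⁻ x, f x = ENNReal.ofReal |LinearMap.det L| * ∫⁻ y, f (x0 + L y) := by
  have hLm : Measurable L := (LinearMap.continuous_of_finiteDimensional L).measurable
  have h1 : ∫⁻ x, f x = ∫⁻ x, f (x0 + x) := (lintegral_add_left_eq_self f x0).symm
  have hg : Measurable fun x => f (x0 + x) := hf.comp (measurable_const_add x0)
  have h2 : ∫⁻ y, f (x0 + L y) = ∫⁻ x, f (x0 + x) ∂(Measure.map L volume) :=
    (lintegral_map hg hLm).symm
  rw [h2, Measure.map_linearMap_addHaar_eq_smul_addHaar volume hL, lintegral_smul_measure,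
    smul_eq_mul, ← mul_assoc, ← ENNReal.ofReal_mul (abs_nonneg _), ← abs_mul,
    mul_inv_cancel₀ hL, abs_one, ENNReal.ofReal_one, one_mul, h1]

/-- Scaling a truncated Gaussian integral. -/
lemma lintegral_gaussian_closedBall_le {l R : ℝ} (hl : 0 ≤ l) :
    ∫⁻ x in Metric.closedBall (0 : Vec d) (2 * R), ENNReal.ofReal (Real.exp (-(l * ‖x‖ ^ 2)))
      ≤ 2 ^ d * ∫⁻ x in Metric.closedBall (0 : Vec d) R,
          ENNReal.ofReal (Real.exp (-(l * ‖x‖ ^ 2))) := by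
  have hm : Measurable fun x : Vec d => ENNReal.ofReal (Real.exp (-(l * ‖x‖ ^ 2))) := by fun_prop
  have hdet : LinearMap.det ((2 : ℝ) • (LinearMap.id : Vec d →ₗ[ℝ] Vec d)) = 2 ^ d := by
    rw [LinearMap.det_smul]; simp
  rw [← lintegral_indicator Metric.isClosed_closedBall.measurableSet,
    ← lintegral_indicator Metric.isClosed_closedBall.measurableSet,
    lintegral_comp_linear (hm.indicator Metric.isClosed_closedBall.measurableSet)
      ((2 : ℝ) • LinearMap.id) (by rw [hdet]; positivity) 0, hdet, abs_of_pos (by positivity),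
    ENNReal.ofReal_pow (by norm_num), ENNReal.ofReal_ofNat]
  refine mul_le_mul_right (lintegral_mono fun y => ?_) _
  have hn : ‖(2 : ℝ) • y‖ = 2 * ‖y‖ := by rw [norm_smul, Real.norm_ofNat]
  have hiff : (2 : ℝ) • y ∈ Metric.closedBall (0 : Vec d) (2 * R)
      ↔ y ∈ Metric.closedBall (0 : Vec d) R := by
    rw [mem_closedBall_zero_iff, mem_closedBall_zero_iff, hn]
    exact mul_le_mul_iff_right₀ (by norm_num)
  simp only [zero_add, LinearMap.smul_apply, LinearMap.id_apply]
  by_cases hy : y ∈ Metric.closedBall (0 : Vec d) R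
  · rw [Set.indicator_of_mem hy, Set.indicator_of_mem (hiff.2 hy), hn]
    refine ENNReal.ofReal_le_ofReal (Real.exp_le_exp.2 (neg_le_neg ?_))
    nlinarith [mul_nonneg hl (sq_nonneg ‖y‖)]
  · rw [Set.indicator_of_notMem hy, Set.indicator_of_notMem (fun h => hy (hiff.1 h))]

/-- Averaging the exponential of an odd function over a ball. -/
lemma lintegral_gaussian_le_of_odd {l R : ℝ} {ℓ : Vec d → ℝ} (hℓm : Measurable ℓ)
    (hℓ : ∀ y, ℓ (-y) = -ℓ y) :
    ∫⁻ y in Metric.closedBall (0 : Vec d) R, ENNReal.ofReal (Real.exp (-(l * ‖y‖ ^ 2)))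
      ≤ ∫⁻ y in Metric.closedBall (0 : Vec d) R,
          ENNReal.ofReal (Real.exp (ℓ y - l * ‖y‖ ^ 2)) := by
  set B := Metric.closedBall (0 : Vec d) R
  have hB : MeasurableSet B := Metric.isClosed_closedBall.measurableSet
  have hsym : ∫⁻ y in B, ENNReal.ofReal (Real.exp (ℓ y - l * ‖y‖ ^ 2))
      = ∫⁻ y in B, ENNReal.ofReal (Real.exp (-ℓ y - l * ‖y‖ ^ 2)) := by
    rw [← lintegral_indicator hB, ← lintegral_indicator hB, ← lintegral_neg_eq_self]
    refine lintegral_congr fun y => ?_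
    have hiff : -y ∈ B ↔ y ∈ B := by
      rw [mem_closedBall_zero_iff, mem_closedBall_zero_iff, norm_neg]
    by_cases hy : y ∈ B
    · rw [Set.indicator_of_mem hy, Set.indicator_of_mem (hiff.2 hy), hℓ, norm_neg]
    · rw [Set.indicator_of_notMem hy, Set.indicator_of_notMem (fun h => hy (hiff.1 h))]
  have h2 : 2 * ∫⁻ y in B, ENNReal.ofReal (Real.exp (-(l * ‖y‖ ^ 2)))
      ≤ 2 * ∫⁻ y in B, ENNReal.ofReal (Real.exp (ℓ y - l * ‖y‖ ^ 2)) := by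
    nth_rw 2 [two_mul]
    nth_rw 2 [hsym]
    rw [← lintegral_const_mul _ (by fun_prop), ← lintegral_add_left (by fun_prop)]
    refine lintegral_mono fun y => ?_
    rw [← ENNReal.ofReal_add (Real.exp_pos _).le (Real.exp_pos _).le, two_mul,
      ← ENNReal.ofReal_add (Real.exp_pos _).le (Real.exp_pos _).le]
    refine ENNReal.ofReal_le_ofReal ?_
    simp only [sub_eq_add_neg, Real.exp_add, ← add_mul]
    rw [← two_mul]
    refine mul_le_mul_of_nonneg_right ?_ (Real.exp_pos _).le
    linarith [Real.add_one_le_exp (ℓ y), Real.add_one_le_exp (-ℓ y)]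
  exact (ENNReal.mul_le_mul_iff_right (by norm_num) (by norm_num)).1 h2

/-- Lower bound on the truncated Gaussian mixture of the exponential process. -/
lemma mixture_lower_bound {A : Matrix (Fin d) (Fin d) ℝ} (hA : A.PosSemidef) {l R : ℝ} (hl : 0 < l)
    (σ ξ : Vec d) (hξ : ‖ξ‖ ≤ R) :
    ENNReal.ofReal (Real.sqrt (l ^ d / (A + l • (1 : Matrix (Fin d) (Fin d) ℝ)).det)
        * Real.exp (inner ℝ ξ σ - ξ.ofLp ⬝ᵥ (A *ᵥ ξ.ofLp) - l * ‖ξ‖ ^ 2))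
      * ∫⁻ x in Metric.closedBall (0 : Vec d) (2 * R), ENNReal.ofReal (Real.exp (-(l * ‖x‖ ^ 2)))
    ≤ 2 ^ d * ∫⁻ x in Metric.closedBall (0 : Vec d) (2 * R),
        ENNReal.ofReal (Real.exp (inner ℝ x σ - x.ofLp ⬝ᵥ (A *ᵥ x.ofLp) - l * ‖x‖ ^ 2)) := by
  set H := A + l • (1 : Matrix (Fin d) (Fin d) ℝ) with hH
  have hP : H.PosDef := posDef_add_smul_one hA hl
  obtain ⟨B, hB⟩ := exists_conjTranspose_mul_self hP.posSemidef
  have hBdet : H.det = B.det ^ 2 := by rw [hB, Matrix.det_mul, Matrix.det_transpose, sq]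
  have hB0 : B.det ≠ 0 := fun h => hP.det_pos.ne' (by rw [hBdet, h]; simp)
  have hBu : IsUnit B.det := isUnit_iff_ne_zero.2 hB0
  -- With H = BᵀB, the map √l·B⁻¹ carries l‖·‖² to the H-form. Since H ≥ l·I it is a contraction, so
  -- ξ plus the image of the ball of radius R stays in the ball of radius 2R.
  set Lm : Matrix (Fin d) (Fin d) ℝ := Real.sqrt l • B⁻¹
  set L : Vec d →ₗ[ℝ] Vec d := Matrix.toLpLin 2 2 Lm
  have hLdet : |LinearMap.det L| = Real.sqrt (l ^ d / H.det) := by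
    rw [LinearMap.det_toLpLin, Matrix.det_smul, Fintype.card_fin, Matrix.det_nonsing_inv,
      Ring.inverse_eq_inv', hBdet, ← Real.sqrt_sq_eq_abs]
    congr 1
    rw [mul_pow, ← pow_mul, mul_comm d, pow_mul, Real.sq_sqrt hl.le, inv_pow, div_eq_mul_inv]
  have hLdet0 : LinearMap.det L ≠ 0 := by
    rw [← abs_pos, hLdet]
    exact Real.sqrt_pos.2 (div_pos (pow_pos hl d) hP.det_pos)
  have hL : ∀ y : Vec d, (L y).ofLp = Lm *ᵥ y.ofLp := fun y => rfl
  have hBL : ∀ y : Vec d, B *ᵥ (L y).ofLp = Real.sqrt l • y.ofLp := fun y => by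
    rw [hL, Matrix.smul_mulVec, Matrix.mulVec_smul, Matrix.mulVec_mulVec,
      Matrix.mul_nonsing_inv _ hBu, Matrix.one_mulVec]
  have hq : ∀ x : Vec d, x.ofLp ⬝ᵥ (A *ᵥ x.ofLp) + l * ‖x‖ ^ 2
      = (B *ᵥ x.ofLp) ⬝ᵥ (B *ᵥ x.ofLp) := fun x => by
    rw [← quad_add_smul_one, ← hH, hB, ← Matrix.mulVec_mulVec, Matrix.dotProduct_mulVec,
      Matrix.vecMul_transpose]
  have hqL : ∀ y : Vec d, (L y).ofLp ⬝ᵥ (A *ᵥ (L y).ofLp) + l * ‖L y‖ ^ 2 = l * ‖y‖ ^ 2 :=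
    fun y => by
      rw [hq, hBL, smul_dotProduct, dotProduct_smul, dotProduct_self_eq_norm_sq, smul_eq_mul,
        smul_eq_mul, ← mul_assoc, Real.mul_self_sqrt hl.le]
  have hLnorm : ∀ y : Vec d, ‖L y‖ ≤ ‖y‖ := fun y => by
    have h1 := hqL y
    have h2 : 0 ≤ (L y).ofLp ⬝ᵥ (A *ᵥ (L y).ofLp) := by
      simpa using hA.dotProduct_mulVec_nonneg (L y).ofLp
    refine le_of_sq_le_sq ?_ (norm_nonneg _)
    have : l * ‖L y‖ ^ 2 ≤ l * ‖y‖ ^ 2 := by linarith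
    exact le_of_mul_le_mul_left this hl
  set ℓ : Vec d → ℝ := fun y =>
    inner ℝ (L y) σ - 2 * ((B *ᵥ ξ.ofLp) ⬝ᵥ (Real.sqrt l • y.ofLp))
  have hLc : Continuous L := LinearMap.continuous_of_finiteDimensional L
  have hℓm : Measurable ℓ := by
    have : Continuous ℓ := by
      refine (hLc.inner continuous_const).sub (continuous_const.mul ?_)
      simp only [dotProduct]
      fun_prop
    exact this.measurable
  have hℓodd : ∀ y, ℓ (-y) = -ℓ y := fun y => by
    simp only [ℓ, map_neg, inner_neg_left, WithLp.ofLp_neg, smul_neg, dotProduct_neg]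
    ring
  set E : Vec d → ℝ := fun x => inner ℝ x σ - x.ofLp ⬝ᵥ (A *ᵥ x.ofLp) - l * ‖x‖ ^ 2
  -- Recentring at ξ leaves only the odd term ℓ besides the Gaussian exponent. Symmetrizing in y
  -- removes it, as e^ℓ + e^(-ℓ) ≥ 2.
  have hE : ∀ y, E (ξ + L y) = E ξ + (ℓ y - l * ‖y‖ ^ 2) := fun y => by
    have e1 := hq (ξ + L y)
    have e2 := hq ξ
    rw [WithLp.ofLp_add, Matrix.mulVec_add B, hBL, Matrix.mulVec_add A] at e1
    simp only [add_dotProduct, dotProduct_add] at e1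
    have e3 : (Real.sqrt l • y.ofLp) ⬝ᵥ (Real.sqrt l • y.ofLp) = l * ‖y‖ ^ 2 := by
      rw [smul_dotProduct, dotProduct_smul, dotProduct_self_eq_norm_sq, smul_eq_mul,
        smul_eq_mul, ← mul_assoc, Real.mul_self_sqrt hl.le]
    rw [e3, dotProduct_comm (Real.sqrt l • y.ofLp)] at e1
    simp only [E, ℓ, inner_add_left, WithLp.ofLp_add, Matrix.mulVec_add, add_dotProduct,
      dotProduct_add] at e1 ⊢
    linarith
  have hEm : Measurable E := by
    have : Continuous E := by
      simp only [E, Matrix.mulVec, dotProduct]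
      fun_prop
    exact this.measurable
  have hball : ∀ r : ℝ, MeasurableSet (Metric.closedBall (0 : Vec d) r) := fun r =>
    Metric.isClosed_closedBall.measurableSet
  set N := ∫⁻ x in Metric.closedBall (0 : Vec d) R, ENNReal.ofReal (Real.exp (-(l * ‖x‖ ^ 2)))
  have hmain : ENNReal.ofReal (Real.sqrt (l ^ d / H.det) * Real.exp (E ξ)) * N
      ≤ ∫⁻ x in Metric.closedBall (0 : Vec d) (2 * R), ENNReal.ofReal (Real.exp (E x)) := by
    rw [← lintegral_indicator (hball _), lintegral_comp_linear
      ((hEm.exp.ennreal_ofReal).indicator (hball _)) L hLdet0 ξ, hLdet,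
      ENNReal.ofReal_mul (Real.sqrt_nonneg _), mul_assoc]
    refine mul_le_mul_right ?_ _
    calc ENNReal.ofReal (Real.exp (E ξ)) * N
        ≤ ENNReal.ofReal (Real.exp (E ξ)) * ∫⁻ y in Metric.closedBall (0 : Vec d) R,
          ENNReal.ofReal (Real.exp (ℓ y - l * ‖y‖ ^ 2)) :=
          mul_le_mul_right (lintegral_gaussian_le_of_odd hℓm hℓodd) _
      _ = ∫⁻ y in Metric.closedBall (0 : Vec d) R, ENNReal.ofReal (Real.exp (E (ξ + L y))) := by
          rw [← lintegral_const_mul _ (by fun_prop)]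
          refine lintegral_congr fun y => ?_
          rw [hE, Real.exp_add, ENNReal.ofReal_mul (Real.exp_pos _).le]
      _ ≤ _ := by
          rw [← lintegral_indicator (hball _)]
          refine lintegral_mono fun y => ?_
          by_cases hy : y ∈ Metric.closedBall (0 : Vec d) R
          · have h2 : ξ + L y ∈ Metric.closedBall (0 : Vec d) (2 * R) := by
              rw [mem_closedBall_zero_iff] at hy ⊢
              linarith [norm_add_le ξ (L y), hLnorm y]
            rw [Set.indicator_of_mem hy, Set.indicator_of_mem h2]
          · rw [Set.indicator_of_notMem hy]
            exact zero_le
  -- Passing from radius 2R to R costs 2^d, the origin of the d log 2 in ρ.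
  calc _ ≤ ENNReal.ofReal (Real.sqrt (l ^ d / H.det) * Real.exp (E ξ)) * (2 ^ d * N) :=
        mul_le_mul_right (lintegral_gaussian_closedBall_le hl.le) _
    _ = 2 ^ d * (ENNReal.ofReal (Real.sqrt (l ^ d / H.det) * Real.exp (E ξ)) * N) := by ring
    _ ≤ _ := mul_le_mul_right hmain _

end Mixture

lemma gaussian_closedBall_ne_top {d : ℕ} {l : ℝ} (hl : 0 ≤ l) (R : ℝ) :
    ∫⁻ x in Metric.closedBall (0 : Vec d) R, ENNReal.ofReal (Real.exp (-(l * ‖x‖ ^ 2))) ≠ ⊤ := by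
  refine ne_top_of_le_ne_top (b := ∫⁻ x in Metric.closedBall (0 : Vec d) R, 1) ?_ ?_
  · simpa using! (measure_closedBall_lt_top (μ := (volume : Measure (Vec d)))).ne
  · refine lintegral_mono fun x => ?_
    rw [ENNReal.ofReal_le_one, Real.exp_le_one_iff, neg_nonpos]
    positivity

lemma gaussian_closedBall_ne_zero {d : ℕ} (l : ℝ) {R : ℝ} (hR : 0 < R) :
    ∫⁻ x in Metric.closedBall (0 : Vec d) R, ENNReal.ofReal (Real.exp (-(l * ‖x‖ ^ 2))) ≠ 0 := by
  have hm : Measurable fun x : Vec d => ENNReal.ofReal (Real.exp (-(l * ‖x‖ ^ 2))) := by fun_prop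
  rw [← pos_iff_ne_zero, setLIntegral_pos_iff hm]
  have : Function.support (fun x : Vec d => ENNReal.ofReal (Real.exp (-(l * ‖x‖ ^ 2))))
      = Set.univ := by
    ext x
    simp [Real.exp_pos]
  rw [this, Set.univ_inter]
  exact Metric.measure_closedBall_pos _ _ hR

/-- Rescaling step turning a bound on a linear minus quadratic form over a ball into a
self-normalized bound. -/
lemma linear_le_of_ball {d : ℕ} {A : Matrix (Fin d) (Fin d) ℝ} (hA : A.PosSemidef) {l m Λ : ℝ}
    (hl : 0 < l) (hm : 0 < m) (σ Δ : Vec d)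
    (h : ∀ ξ : Vec d, ‖ξ‖ ≤ 1 / (2 * m) →
      inner ℝ ξ σ - ξ.ofLp ⬝ᵥ (A *ᵥ ξ.ofLp) - l * ‖ξ‖ ^ 2 ≤ Λ) :
    inner ℝ Δ σ ≤ (Real.sqrt l / (2 * m) + 2 * m / Real.sqrt l * Λ)
      * Real.sqrt (Δ.ofLp ⬝ᵥ (A *ᵥ Δ.ofLp) + l * ‖Δ‖ ^ 2) := by
  by_cases hΔ : Δ = 0
  · simp [hΔ]
  set q := Δ.ofLp ⬝ᵥ (A *ᵥ Δ.ofLp) + l * ‖Δ‖ ^ 2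
  have hqA : 0 ≤ Δ.ofLp ⬝ᵥ (A *ᵥ Δ.ofLp) := by simpa using hA.dotProduct_mulVec_nonneg Δ.ofLp
  have hn : 0 < ‖Δ‖ := norm_pos_iff.2 hΔ
  have hq : 0 < q := add_pos_of_nonneg_of_pos hqA (by positivity)
  set Q := Real.sqrt q
  have hQ : 0 < Q := Real.sqrt_pos.2 hq
  have hQq : Q ^ 2 = q := Real.sq_sqrt hq.le
  set w := Real.sqrt l
  have hw : 0 < w := Real.sqrt_pos.2 hl
  have hwl : w ^ 2 = l := Real.sq_sqrt hl.le
  have hwn : w * ‖Δ‖ ≤ Q := by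
    refine Real.le_sqrt_of_sq_le ?_
    rw [mul_pow, hwl]
    linarith
  -- As √l‖Δ‖ ≤ Q, this scaling puts cΔ in the ball of radius 1/(2m). The quadratic terms then equal
  -- l/(4m²), which becomes the summand √l/(2m) after division by c.
  set c := w / (2 * m * Q)
  have hc : 0 < c := by positivity
  have hb : ‖c • Δ‖ ≤ 1 / (2 * m) := by
    rw [norm_smul, Real.norm_of_nonneg hc.le]
    calc c * ‖Δ‖ = (w * ‖Δ‖) / Q * (1 / (2 * m)) := by simp only [c]; field_simp
      _ ≤ 1 * (1 / (2 * m)) := by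
          refine mul_le_mul_of_nonneg_right ((div_le_one hQ).2 hwn) (by positivity)
      _ = _ := one_mul _
  have h1 := h (c • Δ) hb
  rw [inner_smul_left, WithLp.ofLp_smul, Matrix.mulVec_smul, smul_dotProduct, dotProduct_smul,
    norm_smul, Real.norm_of_nonneg hc.le] at h1
  simp only [smul_eq_mul, conj_trivial] at h1
  have h2 : c * inner ℝ Δ σ - c ^ 2 * Q ^ 2 ≤ Λ := by rw [hQq]; simp only [q]; nlinarith
  have h3 : c ^ 2 * Q ^ 2 = (w / (2 * m)) ^ 2 := by simp only [c]; field_simp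
  have h4 : inner ℝ Δ σ ≤ (Λ + (w / (2 * m)) ^ 2) / c := by
    rw [le_div_iff₀ hc]; linarith
  refine h4.trans (le_of_eq ?_)
  simp only [c]
  field_simp
  ring

/-! ### Self-normalized concentration at a fixed round. -/

namespace Interaction

variable {d T Γ : ℕ} {S k m : ℝ} {Ω : Type*} [MeasurableSpace Ω] (X : Interaction d T Γ S k m Ω)

lemma measurable_logIncrement_prod (v : ℕ → ℝ) {s : ℕ} (h1 : 1 ≤ s) (h2 : s ≤ T) :
    Measurable fun z : Ω × Vec d => X.logIncrement v z.2 s z.1 := by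
  have ha : Measurable (X.a s) := (X.measurable_a s h1 h2).mono (X.ℱ.le _) le_rfl
  have hp : Measurable fun ω => deriv X.μ (X.param s ω) :=
    X.measurable_slope.comp ((X.measurable_param h1 h2).mono (X.ℱ.le _) le_rfl)
  have hn : Measurable (X.noise s) := (X.measurable_noise h1 h2).mono (X.ℱ.le _) le_rfl
  have hy : Measurable fun z : Ω × Vec d => v s * inner ℝ (X.a s z.1) z.2 :=
    ((ha.comp measurable_fst).inner measurable_snd).const_mul _
  exact (hy.mul (hn.comp measurable_fst)).sub ((hy.pow_const 2).mul (hp.comp measurable_fst))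

/-- Self-normalized concentration of the weighted noise at a fixed round. -/
theorem self_normalized_concentration (hd : 1 ≤ d) (hm : 0 < m) {lam δ τ : ℝ} (hlam : 0 < lam)
    (hδ : 0 < δ) {v : ℕ → ℝ} (hv : ∀ s, |v s| ≤ 1) {t : ℕ} (ht1 : 1 ≤ t) (ht : t ≤ T)
    (hτ : k * ∑ s ∈ Finset.Ico 1 t, v s ^ 2 ≤ τ) :
    ∃ E : Set Ω, MeasurableSet E ∧ X.P E ≤ ENNReal.ofReal δ ∧ ∀ ω ∉ E, ∀ Δ : Vec d,
      ∑ s ∈ Finset.Ico 1 t, v s * X.noise s ω * inner ℝ (X.a s ω) Δ ≤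
        (Real.sqrt lam / (2 * m) + 2 * m / Real.sqrt lam *
          (Real.log (1 / δ) + d * Real.log 2 + d / 2 * Real.log (1 + τ / (d * lam)))) *
        Real.sqrt (∑ s ∈ Finset.Ico 1 t, v s ^ 2 * deriv X.μ (X.param s ω)
            * inner ℝ (X.a s ω) Δ ^ 2 + lam * ‖Δ‖ ^ 2) := by
  set I := Finset.Ico 1 t
  have hI : ∀ s ∈ I, 1 ≤ s ∧ s ≤ T := fun s hs => by
    rw [Finset.mem_Ico] at hs; omega
  -- Half the admissible radius: a contracted ball of radius R recentred at some ‖ξ‖ ≤ R still lies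
  -- within norm 1/m.
  set R := 1 / (2 * m) with hR
  have hRpos : 0 < R := by positivity
  have h2R : 2 * R = 1 / m := by rw [hR]; field_simp
  set N := ∫⁻ x in Metric.closedBall (0 : Vec d) (2 * R),
    ENNReal.ofReal (Real.exp (-(lam * ‖x‖ ^ 2))) with hN
  have hNtop : N ≠ ⊤ := gaussian_closedBall_ne_top hlam.le _
  have hN0 : N ≠ 0 := gaussian_closedBall_ne_zero _ (by positivity)
  have hJ : Measurable fun z : Ω × Vec d => ENNReal.ofReal (Real.exp
      (∑ s ∈ I, X.logIncrement v z.2 s z.1 - lam * ‖z.2‖ ^ 2)) := by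
    have := Finset.measurable_fun_sum I fun s hs =>
      X.measurable_logIncrement_prod v (hI s hs).1 (hI s hs).2
    exact (this.sub ((measurable_snd.norm.pow_const 2).const_mul lam)).exp.ennreal_ofReal
  set Φ : Ω → ENNReal := fun ω => ∫⁻ ξ in Metric.closedBall (0 : Vec d) (2 * R),
    ENNReal.ofReal (Real.exp (∑ s ∈ I, X.logIncrement v ξ s ω - lam * ‖ξ‖ ^ 2))
  have hΦ : Measurable Φ := hJ.lintegral_prod_right'
  have hEΦ : ∫⁻ ω, Φ ω ∂X.P ≤ N := by
    simp only [Φ]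
    rw [lintegral_lintegral_swap hJ.aemeasurable]
    refine setLIntegral_mono' Metric.isClosed_closedBall.measurableSet fun ξ hξ => ?_
    rw [mem_closedBall_zero_iff, h2R] at hξ
    have hle := X.lintegral_exp_sum_logIncrement_le hm hv hξ (t - 1) (by omega)
    rw [Nat.sub_add_cancel ht1] at hle
    calc _ = ∫⁻ ω, ENNReal.ofReal (Real.exp (-(lam * ‖ξ‖ ^ 2))) *
          ENNReal.ofReal (Real.exp (∑ s ∈ I, X.logIncrement v ξ s ω)) ∂X.P := by
          refine lintegral_congr fun ω => ?_
          rw [← ENNReal.ofReal_mul (Real.exp_pos _).le, ← Real.exp_add]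
          congr 2; ring
      _ = ENNReal.ofReal (Real.exp (-(lam * ‖ξ‖ ^ 2))) *
          ∫⁻ ω, ENNReal.ofReal (Real.exp (∑ s ∈ I, X.logIncrement v ξ s ω)) ∂X.P :=
          lintegral_const_mul' _ _ ENNReal.ofReal_ne_top
      _ ≤ ENNReal.ofReal (Real.exp (-(lam * ‖ξ‖ ^ 2))) * 1 := mul_le_mul_right hle _
      _ = _ := mul_one _
  -- Markov threshold; the same N occurs in the mixture lower bound and cancels.
  set ε := N / ENNReal.ofReal δ with hε
  have hδ0 : ENNReal.ofReal δ ≠ 0 := by simpa using hδ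
  have hε0 : ε ≠ 0 := ENNReal.div_ne_zero.2 ⟨hN0, ENNReal.ofReal_ne_top⟩
  have hεtop : ε ≠ ⊤ := ENNReal.div_ne_top hNtop hδ0
  refine ⟨{ω | ε ≤ Φ ω}, measurableSet_le measurable_const hΦ, ?_, fun ω hω Δ => ?_⟩
  · refine (meas_ge_le_lintegral_div hΦ.aemeasurable hε0 hεtop).trans
      ((ENNReal.div_le_div_right hEΦ ε).trans (ENNReal.div_le_of_le_mul ?_))
    rw [hε, ENNReal.mul_div_cancel hδ0 ENNReal.ofReal_ne_top]
  · have hω' : Φ ω < ε := not_le.1 hω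
    set w : ℕ → ℝ := fun s => v s ^ 2 * deriv X.μ (X.param s ω)
    have hw : ∀ s ∈ I, 0 ≤ w s := fun s _ =>
      mul_nonneg (sq_nonneg _) (X.toRewardModel.slope_nonneg _)
    set a : ℕ → Vec d := fun s => X.a s ω
    set A := gram I w a
    have hA : A.PosSemidef := posSemidef_gram I w hw a
    have htr : A.trace ≤ τ := by
      rw [trace_gram]
      refine le_trans ?_ hτ
      rw [Finset.mul_sum]
      refine Finset.sum_le_sum fun s hs => ?_
      have h1 : ‖a s‖ ^ 2 ≤ 1 := by
        have := X.norm_a_le (hI s hs).1 (hI s hs).2 ω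
        exact pow_le_one₀ (norm_nonneg _) this
      calc w s * ‖a s‖ ^ 2 ≤ w s := mul_le_of_le_one_right (hw s hs) h1
        _ ≤ v s ^ 2 * k := mul_le_mul_of_nonneg_left (X.toRewardModel.slope_le _) (sq_nonneg _)
        _ = k * v s ^ 2 := mul_comm _ _
    set σ : Vec d := ∑ s ∈ I, (v s * X.noise s ω) • a s
    have hσ : ∀ x : Vec d, inner ℝ x σ = ∑ s ∈ I, v s * X.noise s ω * inner ℝ (a s) x := by
      intro x
      rw [inner_sum]
      refine Finset.sum_congr rfl fun s _ => ?_
      rw [inner_smul_right, real_inner_comm]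
    have hlog : ∀ ξ : Vec d, ∑ s ∈ I, X.logIncrement v ξ s ω
        = inner ℝ ξ σ - ξ.ofLp ⬝ᵥ (A *ᵥ ξ.ofLp) := fun ξ => by
      rw [hσ, quad_gram, ← Finset.sum_sub_distrib]
      refine Finset.sum_congr rfl fun s _ => ?_
      simp only [logIncrement, w, a]
      ring
    have hΦ' : Φ ω = ∫⁻ ξ in Metric.closedBall (0 : Vec d) (2 * R), ENNReal.ofReal
        (Real.exp (inner ℝ ξ σ - ξ.ofLp ⬝ᵥ (A *ᵥ ξ.ofLp) - lam * ‖ξ‖ ^ 2)) := by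
      simp only [Φ, hlog]
    set D := (A + lam • (1 : Matrix (Fin d) (Fin d) ℝ)).det
    have hD : 0 < D := (posDef_add_smul_one hA hlam).det_pos
    have hlin := linear_le_of_ball hA hlam hm σ Δ
      (Λ := Real.log (1 / δ) + d * Real.log 2 + d / 2 * Real.log (1 + τ / (d * lam)))
      fun ξ hξ => by
        set e := inner ℝ ξ σ - ξ.ofLp ⬝ᵥ (A *ᵥ ξ.ofLp) - lam * ‖ξ‖ ^ 2
        have hmix := mixture_lower_bound hA hlam σ ξ hξ
        rw [← hΦ'] at hmix
        have h1 : ENNReal.ofReal (Real.sqrt (lam ^ d / D) * Real.exp e) * N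
            ≤ ENNReal.ofReal (2 ^ d / δ) * N := by
          refine hmix.trans ((mul_le_mul_right hω'.le _).trans (le_of_eq ?_))
          rw [ENNReal.ofReal_div_of_pos hδ, ENNReal.ofReal_pow (by norm_num),
            ENNReal.ofReal_ofNat, hε, div_eq_mul_inv, div_eq_mul_inv]
          ring
        have h2 := (ENNReal.mul_le_mul_iff_left hN0 hNtop).1 h1
        rw [ENNReal.ofReal_le_ofReal_iff (by positivity)] at h2
        have hs : 0 < Real.sqrt (lam ^ d / D) := Real.sqrt_pos.2 (by positivity)
        have h3 := Real.log_le_log (by positivity) h2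
        rw [Real.log_mul hs.ne' (Real.exp_pos _).ne', Real.log_exp, Real.log_sqrt (by positivity),
          Real.log_div (by positivity) hD.ne', Real.log_pow,
          Real.log_div (by positivity) hδ.ne', Real.log_pow] at h3
        have h4 := log_det_add_smul_one_le hd hA hlam htr
        rw [Real.log_div one_ne_zero hδ.ne', Real.log_one]
        linarith
    rw [hσ, quad_gram] at hlin
    exact hlin

end Interaction

/-! ### The deterministic confidence bound and its width. -/

/-- The base of the power `3/2` in the confidence width. -/
noncomputable def widthBase (d T : ℕ) (S k m lam γ δ : ℝ) : ℝ :=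
  1 + Sbar T S k m lam γ + Real.sqrt ((1 + Sbar T S k m lam γ) / lam) * rho d T k m lam γ δ
    + (rho d T k m lam γ δ / Real.sqrt lam) ^ 2

/-- Self-bounding inequality `u ≤ s + q √u`. -/
lemma le_of_le_add_mul_sqrt {u s q : ℝ} (hu : 0 ≤ u) (hs : 0 ≤ s) (hq : 0 ≤ q)
    (h : u ≤ s + q * Real.sqrt u) : u ≤ s + Real.sqrt s * q + q ^ 2 := by
  have h1 := Real.sq_sqrt hu
  have h2 := Real.sq_sqrt hs
  have hu0 := Real.sqrt_nonneg u
  have hs0 := Real.sqrt_nonneg s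
  have h3 : Real.sqrt u ≤ q + Real.sqrt s := by
    by_contra hc
    push Not at hc
    nlinarith [mul_nonneg hq hs0]
  nlinarith [mul_le_mul_of_nonneg_left h3 hq]

/-- Deterministic confidence bound for the regularized weighted maximum-likelihood estimate, given a
self-normalized bound on the noise. -/
lemma confidence_of_self_normalized {d : ℕ} {μ : ℝ → ℝ} (hμ : Differentiable ℝ μ)
    (hμ' : Differentiable ℝ (deriv μ)) (hsc : ∀ x, |deriv (deriv μ) x| ≤ deriv μ x)
    {I : Finset ℕ} {g v r : ℕ → ℝ} {a : ℕ → Vec d} {θ θ' : Vec d} {lam m S s' ρ : ℝ}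
    (hlam : 0 < lam) (hρ : 0 ≤ ρ)
    (hv0 : ∀ s ∈ I, 0 ≤ v s) (hvg : ∀ s ∈ I, v s ≤ g s) (hg1 : ∀ s ∈ I, g s ≤ 1)
    (ha : ∀ s ∈ I, ‖a s‖ ≤ 1) (hθ : ‖θ‖ ≤ S)
    (hgrad : ∀ h : Vec d, ∑ s ∈ I, g s * (μ (inner ℝ (a s) θ') - r s) * inner ℝ (a s) h
      + lam * inner ℝ θ' h = 0)
    (hr : ∀ s ∈ I, |r s - μ (inner ℝ (a s) θ)| ≤ m)
    (hbias : (∑ s ∈ I, (g s - v s)) * m ≤ lam * (s' - S)) (hs' : S ≤ s')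
    (hconc : ∑ s ∈ I, v s * (r s - μ (inner ℝ (a s) θ)) * inner ℝ (a s) (θ' - θ) ≤
      ρ * Real.sqrt (∑ s ∈ I, v s ^ 2 * deriv μ (inner ℝ (a s) θ)
        * inner ℝ (a s) (θ' - θ) ^ 2 + lam * ‖θ' - θ‖ ^ 2)) :
    ∑ s ∈ I, g s * deriv μ (inner ℝ (a s) θ) * inner ℝ (a s) (θ' - θ) ^ 2 + lam * ‖θ' - θ‖ ^ 2
      ≤ lam * (1 + s' + Real.sqrt ((1 + s') / lam) * ρ + (ρ / Real.sqrt lam) ^ 2) ^ 3 := by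
  set Δ := θ' - θ with hΔ
  have hS : 0 ≤ S := (norm_nonneg _).trans hθ
  have hs0 : 0 ≤ s' := hS.trans hs'
  have hn := norm_nonneg Δ
  have hg0 : ∀ s ∈ I, 0 ≤ g s := fun s hs => (hv0 s hs).trans (hvg s hs)
  have hslope : ∀ x, 0 ≤ deriv μ x := fun x => (abs_nonneg _).trans (hsc x)
  have hz : ∀ s, inner ℝ (a s) θ' - inner ℝ (a s) θ = inner ℝ (a s) Δ := fun s => by
    rw [hΔ, inner_sub_right]
  have hzle : ∀ s ∈ I, |inner ℝ (a s) Δ| ≤ ‖Δ‖ := fun s hs => by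
    refine (abs_real_inner_le_norm _ _).trans ?_
    exact mul_le_of_le_one_left hn (ha s hs)
  have hlow : ∀ s, deriv μ (inner ℝ (a s) θ) * inner ℝ (a s) Δ ^ 2 ≤ (1 + |inner ℝ (a s) Δ|) *
      ((μ (inner ℝ (a s) θ') - μ (inner ℝ (a s) θ)) * inner ℝ (a s) Δ) := fun s => by
    have := self_concordant_lower hμ hμ' hsc (inner ℝ (a s) θ) (inner ℝ (a s) θ')
    rwa [hz] at this
  have hterm : ∀ s, 0 ≤ (μ (inner ℝ (a s) θ') - μ (inner ℝ (a s) θ)) * inner ℝ (a s) Δ :=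
    fun s => by
      have h1 := (mul_nonneg (hslope (inner ℝ (a s) θ)) (sq_nonneg (inner ℝ (a s) Δ))).trans
        (hlow s)
      exact nonneg_of_mul_nonneg_right h1 (by positivity)
  -- Secant form of the Hessian quadratic form; the score equation tested against Δ evaluates it
  -- exactly in `hYeq`.
  set Y := ∑ s ∈ I, g s * ((μ (inner ℝ (a s) θ') - μ (inner ℝ (a s) θ)) * inner ℝ (a s) Δ)
    + lam * ‖Δ‖ ^ 2 with hY
  have hsum0 : 0 ≤ ∑ s ∈ I, g s *
      ((μ (inner ℝ (a s) θ') - μ (inner ℝ (a s) θ)) * inner ℝ (a s) Δ) :=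
    Finset.sum_nonneg fun s hs => mul_nonneg (hg0 s hs) (hterm s)
  have hY0 : 0 ≤ Y := by positivity
  set x := Real.sqrt Y
  have hx0 : 0 ≤ x := Real.sqrt_nonneg _
  have hxY : x ^ 2 = Y := Real.sq_sqrt hY0
  set w := Real.sqrt lam
  have hw : 0 < w := Real.sqrt_pos.2 hlam
  have hwl : w ^ 2 = lam := Real.sq_sqrt hlam.le
  have hΔx : ‖Δ‖ ≤ x / w := by
    rw [le_div_iff₀ hw, mul_comm]
    refine Real.le_sqrt_of_sq_le ?_
    rw [mul_pow, hwl]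
    linarith
  -- Since |aᵀΔ| ≤ ‖Δ‖ ≤ x/w, this dominates all the self-concordance factors 1 + |aᵀΔ|.
  set u := 1 + x / w with hu
  have hu1 : 1 ≤ u := by
    have : 0 ≤ x / w := by positivity
    linarith
  set Q := ∑ s ∈ I, g s * deriv μ (inner ℝ (a s) θ) * inner ℝ (a s) Δ ^ 2 + lam * ‖Δ‖ ^ 2
  have hQu : Q ≤ u * x ^ 2 := by
    rw [hxY, hY, mul_add, Finset.mul_sum]
    refine add_le_add (Finset.sum_le_sum fun s hs => ?_)
      (le_mul_of_one_le_left (by positivity) hu1)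
    have h1 : (1 + |inner ℝ (a s) Δ|) *
        ((μ (inner ℝ (a s) θ') - μ (inner ℝ (a s) θ)) * inner ℝ (a s) Δ) ≤ u *
        ((μ (inner ℝ (a s) θ') - μ (inner ℝ (a s) θ)) * inner ℝ (a s) Δ) :=
      mul_le_mul_of_nonneg_right (by linarith [hzle s hs]) (hterm s)
    have h2 := mul_le_mul_of_nonneg_left ((hlow s).trans h1) (hg0 s hs)
    linarith
  -- 0 ≤ v ≤ g ≤ 1 gives v² ≤ g, so the noise normalization is dominated by the Hessian of the
  -- estimator.
  have hvQ : ∑ s ∈ I, v s ^ 2 * deriv μ (inner ℝ (a s) θ) * inner ℝ (a s) Δ ^ 2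
      + lam * ‖Δ‖ ^ 2 ≤ Q := by
    refine add_le_add (Finset.sum_le_sum fun s hs => ?_) le_rfl
    have : v s ^ 2 ≤ g s := by
      have h1 := hv0 s hs; have h2 := hvg s hs; have h3 := hg1 s hs
      nlinarith
    exact mul_le_mul_of_nonneg_right (mul_le_mul_of_nonneg_right this (hslope _)) (sq_nonneg _)
  have hconc' : ∑ s ∈ I, v s * (r s - μ (inner ℝ (a s) θ)) * inner ℝ (a s) Δ
      ≤ ρ * (Real.sqrt u * x) := by
    refine hconc.trans (mul_le_mul_of_nonneg_left ?_ hρ)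
    calc _ ≤ Real.sqrt (u * x ^ 2) := Real.sqrt_le_sqrt (hvQ.trans hQu)
      _ = Real.sqrt u * x := by rw [Real.sqrt_mul (by linarith), Real.sqrt_sq hx0]
  -- Residuals carried by g − v need not be centred, so only their size enters.
  have hb : ∑ s ∈ I, (g s - v s) * (r s - μ (inner ℝ (a s) θ)) * inner ℝ (a s) Δ
      ≤ lam * (s' - S) * ‖Δ‖ := by
    calc _ ≤ ∑ s ∈ I, (g s - v s) * m * ‖Δ‖ := by
          refine Finset.sum_le_sum fun s hs => ?_
          rw [mul_assoc, mul_assoc]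
          refine mul_le_mul_of_nonneg_left ?_ (sub_nonneg.2 (hvg s hs))
          refine (le_abs_self _).trans ?_
          rw [abs_mul]
          exact mul_le_mul (hr s hs) (hzle s hs) (abs_nonneg _) ((abs_nonneg _).trans (hr s hs))
      _ = (∑ s ∈ I, (g s - v s)) * m * ‖Δ‖ := by rw [← Finset.sum_mul, ← Finset.sum_mul]
      _ ≤ _ := mul_le_mul_of_nonneg_right hbias hn
  have hθΔ : -(lam * inner ℝ θ Δ) ≤ lam * S * ‖Δ‖ := by
    have h1 := (neg_le_abs _).trans (abs_real_inner_le_norm θ Δ)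
    have h2 : ‖θ‖ * ‖Δ‖ ≤ S * ‖Δ‖ := mul_le_mul_of_nonneg_right hθ hn
    nlinarith
  have hYeq : Y = ∑ s ∈ I, v s * (r s - μ (inner ℝ (a s) θ)) * inner ℝ (a s) Δ
      + ∑ s ∈ I, (g s - v s) * (r s - μ (inner ℝ (a s) θ)) * inner ℝ (a s) Δ
      - lam * inner ℝ θ Δ := by
    have h1 := hgrad Δ
    have h2 : inner ℝ θ' Δ = inner ℝ θ Δ + ‖Δ‖ ^ 2 := by
      rw [← real_inner_self_eq_norm_sq, ← inner_add_left]
      simp [hΔ]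
    have h3 : ∑ s ∈ I, g s * ((μ (inner ℝ (a s) θ') - μ (inner ℝ (a s) θ)) * inner ℝ (a s) Δ)
        = ∑ s ∈ I, g s * (μ (inner ℝ (a s) θ') - r s) * inner ℝ (a s) Δ
          + (∑ s ∈ I, v s * (r s - μ (inner ℝ (a s) θ)) * inner ℝ (a s) Δ
          + ∑ s ∈ I, (g s - v s) * (r s - μ (inner ℝ (a s) θ)) * inner ℝ (a s) Δ) := by
      rw [← Finset.sum_add_distrib, ← Finset.sum_add_distrib]
      refine Finset.sum_congr rfl fun s _ => ?_
      ring
    rw [hY, h3]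
    rw [h2] at h1
    linarith
  have hmain : x ^ 2 ≤ (ρ * Real.sqrt u + w * s') * x := by
    have h1 : lam * s' * ‖Δ‖ ≤ w * s' * x := by
      have : lam * s' * (x / w) = w * s' * x := by rw [← hwl]; field_simp
      rw [← this]
      exact mul_le_mul_of_nonneg_left hΔx (by positivity)
    rw [hxY, hYeq]
    nlinarith
  have hx : x ≤ ρ * Real.sqrt u + w * s' := by
    rcases hx0.eq_or_lt with h0 | h0
    · rw [← h0]; positivity
    · exact le_of_mul_le_mul_right (by nlinarith) h0
  -- Division by √λ makes the bound on x a self-bounding inequality in u alone.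
  have hule : u ≤ (1 + s') + ρ / w * Real.sqrt u := by
    have : x / w ≤ (ρ * Real.sqrt u + w * s') / w := div_le_div_of_nonneg_right hx hw.le
    have h2 : (ρ * Real.sqrt u + w * s') / w = ρ / w * Real.sqrt u + s' := by field_simp
    linarith
  have hW := le_of_le_add_mul_sqrt (by linarith) (by linarith) (by positivity) hule
  have hsq : Real.sqrt (1 + s') * (ρ / w) = Real.sqrt ((1 + s') / lam) * ρ := by
    rw [Real.sqrt_div (by linarith)]
    ring
  rw [hsq] at hW
  have hxu : x = w * (u - 1) := by rw [hu]; field_simp; ring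
  -- x² = λ(u − 1)², hence ux² ≤ λu³; this cube produces the exponent 3/2 of the width.
  calc Q ≤ u * x ^ 2 := hQu
    _ = lam * (u * (u - 1) ^ 2) := by rw [hxu, mul_pow, hwl]; ring
    _ ≤ lam * u ^ 3 := by
        refine mul_le_mul_of_nonneg_left ?_ hlam.le
        nlinarith
    _ ≤ _ := mul_le_mul_of_nonneg_left (pow_le_pow_left₀ (by linarith) hW 3) hlam.le

lemma rho_nonneg {d T : ℕ} {k m lam γ δ : ℝ} (hT : 1 ≤ T) (hk : 0 ≤ k) (hm : 0 < m)
    (hlam : 0 < lam) (hγ0 : 0 < γ) (hγ1 : γ < 1) (hδ : 0 < δ) (hδ1 : δ ≤ 1) :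
    0 ≤ rho d T k m lam γ δ := by
  have hT1 : (1 : ℝ) ≤ T := by exact_mod_cast hT
  have h1 : 0 ≤ Real.log (T / δ) := Real.log_nonneg (by rw [le_div_iff₀ hδ]; linarith)
  have h2 : 0 ≤ Real.log 2 := Real.log_nonneg (by norm_num)
  have h3 : 0 ≤ k * (1 - ((T : ℝ) ^ 2)⁻¹) / (d * lam * (1 - γ ^ 2)) := by
    have : ((T : ℝ) ^ 2)⁻¹ ≤ 1 := inv_le_one_of_one_le₀ (one_le_pow₀ hT1)
    have h4 : 0 ≤ 1 - γ ^ 2 := by nlinarith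
    have h5 : 0 ≤ 1 - ((T : ℝ) ^ 2)⁻¹ := by linarith
    positivity
  have h4 : 0 ≤ Real.log (1 + k * (1 - ((T : ℝ) ^ 2)⁻¹) / (d * lam * (1 - γ ^ 2))) :=
    Real.log_nonneg (by linarith)
  unfold rho
  positivity

lemma radius_le_Sbar {T : ℕ} {S k m lam γ : ℝ} (hS : 0 ≤ S) (hk : 0 ≤ k) (hm : 0 < m)
    (hlam : 0 < lam) (hγ1 : γ < 1) : S ≤ Sbar T S k m lam γ := by
  have : 0 < 1 - γ := by linarith
  unfold Sbar
  have h : 0 ≤ (2 * S * k + m) / (T * lam * (1 - γ)) := by positivity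
  linarith

lemma one_le_widthBase {d T : ℕ} {S k m lam γ δ : ℝ} (hS : 0 ≤ S) (hT : 1 ≤ T) (hk : 0 ≤ k)
    (hm : 0 < m) (hlam : 0 < lam) (hγ0 : 0 < γ) (hγ1 : γ < 1) (hδ : 0 < δ) (hδ1 : δ ≤ 1) :
    1 ≤ widthBase d T S k m lam γ δ := by
  have h1 := rho_nonneg (d := d) hT hk hm hlam hγ0 hγ1 hδ hδ1
  have h2 := hS.trans (radius_le_Sbar (T := T) hS hk hm hlam hγ1)
  unfold widthBase
  have h3 : 0 ≤ Real.sqrt ((1 + Sbar T S k m lam γ) / lam) * rho d T k m lam γ δ := by positivity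
  nlinarith [sq_nonneg (rho d T k m lam γ δ / Real.sqrt lam)]

lemma beta_eq_sqrt {d T : ℕ} {S k m lam γ δ : ℝ} (hlam : 0 < lam)
    (hW : 0 ≤ widthBase d T S k m lam γ δ) :
    beta d T S k m lam γ δ = k * Real.sqrt (lam * widthBase d T S k m lam γ δ ^ 3) := by
  have h : widthBase d T S k m lam γ δ ^ (3 / 2 : ℝ)
      = Real.sqrt (widthBase d T S k m lam γ δ ^ 3) := by
    rw [Real.sqrt_eq_rpow, ← Real.rpow_natCast, ← Real.rpow_mul hW]
    norm_num
  rw [Real.sqrt_mul hlam.le, ← h, ← mul_assoc]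
  rfl

/-! ### From the estimate to the regret of one round. -/

namespace Interaction

variable {d T Γ : ℕ} {S k m : ℝ} {Ω : Type*} [MeasurableSpace Ω] (X : Interaction d T Γ S k m Ω)

/-- First-order optimality of the weighted maximum-likelihood estimate. -/
lemma loss_first_order {lam γ : ℝ} {t : ℕ} {ω : Ω} {θ' : Vec d}
    (hmin : IsMinOn (X.loss lam γ t ω) Set.univ θ') (h : Vec d) :
    ∑ s ∈ Finset.Ico 1 t, γ ^ (t - 1 - s) * (X.μ (inner ℝ (X.a s ω) θ') - X.r (s + 1) ω)
      * inner ℝ (X.a s ω) h + lam * inner ℝ θ' h = 0 := by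
  have hb : Differentiable ℝ X.b := X.contDiff_b.differentiable (by norm_num)
  set φ : ℝ → ℝ := fun τ => X.loss lam γ t ω (θ' + τ • h)
  have hφ : φ = fun τ => -(∑ s ∈ Finset.Ico 1 t, γ ^ (t - 1 - s) *
      (X.r (s + 1) ω * (inner ℝ (X.a s ω) θ' + τ * inner ℝ (X.a s ω) h)
        - X.b (inner ℝ (X.a s ω) θ' + τ * inner ℝ (X.a s ω) h) + X.c (X.r (s + 1) ω)))
      + lam / 2 * (‖θ'‖ ^ 2 + 2 * (τ * inner ℝ θ' h) + τ ^ 2 * ‖h‖ ^ 2) := by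
    ext τ
    simp only [φ, loss, density, Real.log_exp, inner_add_right, inner_smul_right]
    rw [norm_add_sq_real, norm_smul, mul_pow, Real.norm_eq_abs, sq_abs, inner_smul_right]
  have hs : ∀ s, HasDerivAt (fun τ : ℝ => γ ^ (t - 1 - s) *
      (X.r (s + 1) ω * (inner ℝ (X.a s ω) θ' + τ * inner ℝ (X.a s ω) h)
        - X.b (inner ℝ (X.a s ω) θ' + τ * inner ℝ (X.a s ω) h) + X.c (X.r (s + 1) ω)))
      (γ ^ (t - 1 - s) * (X.r (s + 1) ω * inner ℝ (X.a s ω) h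
        - X.μ (inner ℝ (X.a s ω) θ') * inner ℝ (X.a s ω) h)) 0 := fun s => by
    have hl : HasDerivAt (fun τ : ℝ => inner ℝ (X.a s ω) θ' + τ * inner ℝ (X.a s ω) h)
        (inner ℝ (X.a s ω) h) 0 := by
      simpa using ((hasDerivAt_id (0 : ℝ)).mul_const (inner ℝ (X.a s ω) h)).const_add
        (inner ℝ (X.a s ω) θ')
    have hbd : HasDerivAt X.b (X.μ (inner ℝ (X.a s ω) θ'))
        (inner ℝ (X.a s ω) θ' + 0 * inner ℝ (X.a s ω) h) := by
      rw [zero_mul, add_zero]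
      exact (hb _).hasDerivAt
    have hc : HasDerivAt (fun τ : ℝ => X.b (inner ℝ (X.a s ω) θ' + τ * inner ℝ (X.a s ω) h))
        (X.μ (inner ℝ (X.a s ω) θ') * inner ℝ (X.a s ω) h) 0 := hbd.comp (0 : ℝ) hl
    exact (((hl.const_mul (X.r (s + 1) ω)).sub hc).add_const _).const_mul _
  have hq : HasDerivAt (fun τ : ℝ => lam / 2 * (‖θ'‖ ^ 2 + 2 * (τ * inner ℝ θ' h)
      + τ ^ 2 * ‖h‖ ^ 2)) (lam * inner ℝ θ' h) 0 := by
    have h1 := ((((hasDerivAt_id (0 : ℝ)).mul_const (inner ℝ θ' h)).const_mul 2).const_add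
      (‖θ'‖ ^ 2)).add ((hasDerivAt_pow 2 (0 : ℝ)).mul_const (‖h‖ ^ 2)) |>.const_mul (lam / 2)
    refine h1.congr_deriv ?_
    simp; ring
  have hd : HasDerivAt φ (-(∑ s ∈ Finset.Ico 1 t, γ ^ (t - 1 - s) *
      (X.r (s + 1) ω * inner ℝ (X.a s ω) h
        - X.μ (inner ℝ (X.a s ω) θ') * inner ℝ (X.a s ω) h)) + lam * inner ℝ θ' h) 0 := by
    rw [hφ]
    exact (HasDerivAt.fun_sum fun s _ => hs s).neg.add hq
  have hloc : IsLocalMin φ 0 := by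
    refine Filter.Eventually.of_forall fun τ => ?_
    simp only [φ, zero_smul, add_zero]
    exact hmin (Set.mem_univ _)
  have h0 := hloc.hasDerivAt_eq_zero hd
  rw [← h0, ← Finset.sum_neg_distrib]
  congr 1
  refine Finset.sum_congr rfl fun s _ => ?_
  ring

lemma V_eq_gram (lam γ : ℝ) (t : ℕ) (ω : Ω) :
    X.V lam γ t ω = gram (Finset.Ico 1 t) (fun s => γ ^ (t - 1 - s)) (fun s => X.a s ω)
      + (lam / X.cμ) • (1 : Matrix (Fin d) (Fin d) ℝ) := rfl

lemma posDef_V {lam γ : ℝ} (hlam : 0 < lam) (hγ : 0 ≤ γ) (t : ℕ) (ω : Ω) :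
    (X.V lam γ t ω).PosDef := by
  rw [V_eq_gram]
  exact posDef_add_smul_one (posSemidef_gram _ _ (fun s _ => pow_nonneg hγ _) _)
    (div_pos hlam X.toRewardModel.cμ_pos)

/-- Prediction error of an estimate lying in the confidence set. -/
lemma prediction_error_le {lam γ δ : ℝ} (hlam : 0 < lam) (hγ0 : 0 < γ) (hγ1 : γ < 1)
    (hm : 0 < m) (hδ : 0 < δ) (hδ1 : δ ≤ 1) {t : ℕ} (ht1 : 1 ≤ t) (ht : t ≤ T) {ω : Ω}
    {θ' : Vec d}
    (hQ : ∑ s ∈ Finset.Ico 1 t, γ ^ (t - 1 - s) * deriv X.μ (inner ℝ (X.a s ω) (X.θ t))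
        * inner ℝ (X.a s ω) (θ' - X.θ t) ^ 2 + lam * ‖θ' - X.θ t‖ ^ 2
      ≤ lam * widthBase d T S k m lam γ δ ^ 3) (x : Vec d) :
    |X.μ (inner ℝ x θ') - X.μ (inner ℝ x (X.θ t))| ≤
      beta d T S k m lam γ δ / Real.sqrt X.cμ * invNorm (X.V lam γ t ω) x := by
  have hT := ht1.trans ht
  have hc := X.toRewardModel.cμ_pos
  have hS := X.radius_nonneg hT
  have hk : 0 ≤ k := hc.le.trans (X.toRewardModel.cμ_le hS)
  have hW : 0 ≤ widthBase d T S k m lam γ δ :=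
    zero_le_one.trans (one_le_widthBase hS hT hk hm hlam hγ0 hγ1 hδ hδ1)
  set Δ := θ' - X.θ t with hΔ
  have hCS := abs_inner_le_invNorm_mul (X.posDef_V hlam hγ0.le t ω) x Δ
  -- cμ is compared only with slopes at the true parameter, which has norm at most S; the estimate
  -- may lie anywhere.
  have hquad : Δ.ofLp ⬝ᵥ (X.V lam γ t ω *ᵥ Δ.ofLp)
      ≤ lam * widthBase d T S k m lam γ δ ^ 3 / X.cμ := by
    rw [V_eq_gram, quad_add_smul_one, quad_gram, le_div_iff₀ hc, add_mul, Finset.sum_mul]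
    refine le_trans (add_le_add (Finset.sum_le_sum fun s hs => ?_) (le_of_eq ?_)) hQ
    · rw [Finset.mem_Ico] at hs
      have h1 := X.toRewardModel.cμ_le_slope (X.norm_θ_le t ht1 ht)
        (X.norm_a_le hs.1 (by omega) ω)
      have h2 : 0 ≤ γ ^ (t - 1 - s) * inner ℝ (X.a s ω) Δ ^ 2 := by positivity
      have h3 := mul_le_mul_of_nonneg_left h1 h2
      calc _ ≤ _ := h3
        _ = _ := by ring
    · field_simp
  have hsq : Real.sqrt (Δ.ofLp ⬝ᵥ (X.V lam γ t ω *ᵥ Δ.ofLp))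
      ≤ Real.sqrt (lam * widthBase d T S k m lam γ δ ^ 3) / Real.sqrt X.cμ := by
    rw [← Real.sqrt_div (by positivity)]
    exact Real.sqrt_le_sqrt hquad
  have hinv : 0 ≤ invNorm (X.V lam γ t ω) x := Real.sqrt_nonneg _
  calc _ ≤ k * |inner ℝ x θ' - inner ℝ x (X.θ t)| := X.lipschitz _ _
    _ = k * |inner ℝ x Δ| := by rw [hΔ, inner_sub_right]
    _ ≤ k * (invNorm (X.V lam γ t ω) x *
        (Real.sqrt (lam * widthBase d T S k m lam γ δ ^ 3) / Real.sqrt X.cμ)) :=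
        mul_le_mul_of_nonneg_left (hCS.trans (mul_le_mul_of_nonneg_left hsq hinv)) hk
    _ = _ := by rw [beta_eq_sqrt hlam hW]; ring

/-- Per-round regret of the optimistic action. -/
lemma instant_regret_le_of_prediction_error {lam γ δ : ℝ} {t : ℕ} (ht1 : 1 ≤ t) (ht : t ≤ T)
    {ω : Ω} {θ' : Vec d}
    (hpred : ∀ x : Vec d, |X.μ (inner ℝ x θ') - X.μ (inner ℝ x (X.θ t))| ≤
      beta d T S k m lam γ δ / Real.sqrt X.cμ * invNorm (X.V lam γ t ω) x)
    (hmax : IsMaxOn (X.ucb lam γ δ t ω θ') (X.A t ω) (X.a t ω)) :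
    sSup ((fun x : Vec d => X.μ (inner ℝ x (X.θ t))) '' X.A t ω)
      - X.μ (inner ℝ (X.a t ω) (X.θ t))
      ≤ 2 * (beta d T S k m lam γ δ / Real.sqrt X.cμ) * invNorm (X.V lam γ t ω) (X.a t ω) := by
  rw [sub_le_iff_le_add]
  refine csSup_le ⟨_, X.a t ω, X.a_mem t ht1 ht ω, rfl⟩ ?_
  rintro _ ⟨x, hx, rfl⟩
  have h1 := (abs_le.1 (hpred x)).1
  have h2 := (abs_le.1 (hpred (X.a t ω))).2
  have h3 : X.ucb lam γ δ t ω θ' x ≤ X.ucb lam γ δ t ω θ' (X.a t ω) := hmax hx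
  simp only [ucb] at h3
  dsimp only
  linarith

/-- Means lie in [0, m]; this is the price charged to each round after a change. -/
lemma instant_regret_le {t : ℕ} (ht1 : 1 ≤ t) (ht : t ≤ T) (ω : Ω) :
    sSup ((fun x : Vec d => X.μ (inner ℝ x (X.θ t))) '' X.A t ω)
      - X.μ (inner ℝ (X.a t ω) (X.θ t)) ≤ m := by
  have h0 := (X.μ_mem_Icc (ht1.trans ht) (inner ℝ (X.a t ω) (X.θ t))).1
  rw [sub_le_iff_le_add]
  refine csSup_le ⟨_, X.a t ω, X.a_mem t ht1 ht ω, rfl⟩ ?_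
  rintro _ ⟨x, hx, rfl⟩
  have := (X.μ_mem_Icc (ht1.trans ht) (inner ℝ x (X.θ t))).2
  dsimp only
  linarith

end Interaction

/-! ### Window weights and scalar logarithm bounds. -/

lemma sum_Ico_one_reflect {α : Type*} [AddCommMonoid α] (f : ℕ → α) (t : ℕ) :
    ∑ s ∈ Finset.Ico 1 t, f (t - 1 - s) = ∑ i ∈ Finset.range (t - 1), f i := by
  rw [Finset.sum_Ico_eq_sum_range, ← Finset.sum_range_reflect f]
  refine Finset.sum_congr rfl fun i _ => ?_
  congr 1
  omega

/-- Truncated geometric weights: full up to a window `D`, with a fractional boundary weight. -/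
lemma exists_window_weights {γ : ℝ} (hγ : 1 / 2 < γ) (hγ1 : γ < 1) {T : ℕ} (hT : 1 ≤ T) :
    ∃ (D : ℕ) (w : ℕ → ℝ), (∀ i, 0 ≤ w i ∧ w i ≤ γ ^ i) ∧ (∀ i, D < i → w i = 0) ∧
      (∀ n, ∑ i ∈ Finset.range n, w i ^ 2 ≤ (1 - ((T : ℝ) ^ 2)⁻¹) / (1 - γ ^ 2)) ∧
      (∀ n, ∑ i ∈ Finset.range n, (γ ^ i - w i) ≤ 1 / (T * (1 - γ))) ∧
      (2 ≤ T → (D : ℝ) + 1 ≤ 2 * Real.log T / (1 - γ)) := by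
  have hγ0 : 0 < γ := by linarith
  have hT1 : (1 : ℝ) ≤ T := by exact_mod_cast hT
  have hTpos : (0 : ℝ) < T := by linarith
  have h1γ : 0 < 1 - γ := by linarith
  -- D is determined by γ^(D+1) < 1/T ≤ γ^D.
  obtain ⟨D, hD1, hD2⟩ := exists_nat_pow_near_of_lt_one (x := (T : ℝ)⁻¹) (y := γ)
    (by positivity) (inv_le_one_of_one_le₀ hT1) hγ0 hγ1
  set g := γ ^ D with hg
  set e := (T : ℝ)⁻¹ with he
  have hg0 : 0 < g := by positivity
  have he0 : 0 < e := by positivity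
  have hge : γ * g ≤ e := by rw [pow_succ, ← hg, mul_comm] at hD1; exact hD1.le
  -- Chosen so that the weights sum to (1 − 1/T)/(1 − γ), which makes the mass discarded from the
  -- full geometric series exactly 1/(T(1 − γ)). Keeping all of γ^D would break the bound on
  -- squares, and dropping it would in general break the bound on discarded mass.
  set b := (g - e) / (1 - γ) with hb
  have hb0 : 0 ≤ b := div_nonneg (by linarith) h1γ.le
  have hbg : b ≤ g := by rw [hb, div_le_iff₀ h1γ]; linarith
  set w : ℕ → ℝ := fun i => if i < D then γ ^ i else if i = D then b else 0 with hw
  have hwlt : ∀ i, i < D → w i = γ ^ i := fun i hi => by simp [hw, hi]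
  have hwD : w D = b := by simp [hw]
  have hwgt : ∀ i, D < i → w i = 0 := fun i hi => by
    simp [hw, not_lt.2 hi.le, hi.ne']
  have hw0 : ∀ i, 0 ≤ w i ∧ w i ≤ γ ^ i := fun i => by
    rcases lt_trichotomy i D with h | h | h
    · rw [hwlt i h]; exact ⟨by positivity, le_rfl⟩
    · rw [h, hwD]; exact ⟨hb0, hbg⟩
    · rw [hwgt i h]; exact ⟨le_rfl, by positivity⟩
  have htail : ∀ (f : ℕ → ℝ), (∀ i, D < i → f i = 0) → ∀ n,
      ∑ i ∈ Finset.range (D + 1 + n), f i = ∑ i ∈ Finset.range (D + 1), f i := fun f hf n => by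
    rw [Finset.sum_range_add, add_eq_left]
    exact Finset.sum_eq_zero fun i _ => hf _ (by omega)
  have hgeom : ∀ x : ℝ, x ≠ 1 → ∀ n, ∑ i ∈ Finset.range n, x ^ i = (1 - x ^ n) / (1 - x) :=
    fun x hx n => by
      rw [geom_sum_eq hx, ← neg_sub, ← neg_sub 1 x, neg_div_neg_eq]
  refine ⟨D, w, hw0, hwgt, fun n => ?_, fun n => ?_, fun h2 => ?_⟩
  · calc ∑ i ∈ Finset.range n, w i ^ 2 ≤ ∑ i ∈ Finset.range (D + 1 + n), w i ^ 2 :=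
          Finset.sum_le_sum_of_subset_of_nonneg
            (Finset.range_subset_range.2 (Nat.le_add_left _ _)) fun i _ _ => sq_nonneg _
      _ = ∑ i ∈ Finset.range (D + 1), w i ^ 2 :=
          htail (fun i => w i ^ 2) (fun i hi => by simp [hwgt i hi]) n
      _ = (1 - g ^ 2) / (1 - γ ^ 2) + b ^ 2 := by
          rw [Finset.sum_range_succ, hwD]
          congr 1
          have : ∑ i ∈ Finset.range D, w i ^ 2 = ∑ i ∈ Finset.range D, (γ ^ 2) ^ i :=
            Finset.sum_congr rfl fun i hi => by
              rw [hwlt i (Finset.mem_range.1 hi), ← pow_mul, ← pow_mul, mul_comm]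
          rw [this, hgeom _ (by nlinarith), hg, ← pow_mul, ← pow_mul, mul_comm]
      _ ≤ _ := by
          have hγ2 : 0 < 1 - γ ^ 2 := by nlinarith
          rw [← inv_pow, ← he, div_add' _ _ _ hγ2.ne']
          refine div_le_div_of_nonneg_right ?_ hγ2.le
          have h3 : b ^ 2 * (1 - γ ^ 2) = (g - e) ^ 2 * (1 + γ) / (1 - γ) := by
            rw [hb]; field_simp; ring
          have h4 : (g - e) ^ 2 * (1 + γ) / (1 - γ) ≤ g ^ 2 - e ^ 2 := by
            rw [div_le_iff₀ h1γ]
            -- Equivalent to γ^(D+1) ≤ 1/T.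
            have h5 : (g - e) * (1 + γ) ≤ (g + e) * (1 - γ) := by linarith
            have h6 : 0 ≤ g - e := by linarith
            nlinarith [mul_le_mul_of_nonneg_left h5 h6]
          linarith
  · calc ∑ i ∈ Finset.range n, (γ ^ i - w i)
        ≤ ∑ i ∈ Finset.range (D + 1 + n), (γ ^ i - w i) :=
          Finset.sum_le_sum_of_subset_of_nonneg
            (Finset.range_subset_range.2 (Nat.le_add_left _ _))
            fun i _ _ => sub_nonneg.2 (hw0 i).2
      _ = (1 - γ ^ (D + 1 + n)) / (1 - γ) - ((1 - g) / (1 - γ) + b) := by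
          rw [Finset.sum_sub_distrib, htail w hwgt, hgeom γ hγ1.ne, Finset.sum_range_succ, hwD,
            Finset.sum_congr rfl fun i hi => hwlt i (Finset.mem_range.1 hi), hgeom γ hγ1.ne]
      _ = (e - γ ^ (D + 1 + n)) / (1 - γ) := by rw [hb]; field_simp; ring
      _ ≤ e / (1 - γ) := by
          refine div_le_div_of_nonneg_right ?_ h1γ.le
          have : 0 ≤ γ ^ (D + 1 + n) := by positivity
          linarith
      _ = _ := by rw [he]; field_simp
  · have h3 : (D : ℝ) * (1 - γ) ≤ Real.log T := by
      have h4 := Real.log_le_log he0 hD2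
      rw [he, Real.log_inv, hg, Real.log_pow] at h4
      have h5 := Real.log_le_sub_one_of_pos hγ0
      have h6 : (0 : ℝ) ≤ D := Nat.cast_nonneg D
      nlinarith
    -- γ > 1/2 gives 1 − γ < 1/2 ≤ log T, which pays for the extra round in D + 1.
    have h7 : 1 / 2 ≤ Real.log T := by
      have : Real.log 2 ≤ Real.log T := Real.log_le_log (by norm_num) (by exact_mod_cast h2)
      linarith [Real.log_two_gt_d9]
    rw [le_div_iff₀ h1γ]
    linarith

/-- log(1 + y) ≥ y/(1 + y), and 1 + y ≤ 2 max(1, B). -/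
lemma le_two_mul_max_mul_log {y B : ℝ} (hy : 0 ≤ y) (hB : y ≤ B) :
    y ≤ 2 * max 1 B * Real.log (1 + y) := by
  have h1 : y / (1 + y) ≤ Real.log (1 + y) := by
    have := Real.one_sub_inv_le_log_of_pos (x := 1 + y) (by linarith)
    have e : y / (1 + y) = 1 - (1 + y)⁻¹ := by field_simp; ring
    rwa [e]
  have h2 : y ≤ 2 * max 1 B * (y / (1 + y)) := by
    rw [mul_div_assoc', le_div_iff₀ (by linarith)]
    have h3 := le_max_left 1 B
    have h4 : y ≤ max 1 B := hB.trans (le_max_right 1 B)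
    nlinarith
  exact h2.trans (mul_le_mul_of_nonneg_left h1 (by positivity))

/-! ### Elliptical potential with forgetting. -/

namespace Interaction

variable {d T Γ : ℕ} {S k m : ℝ} {Ω : Type*} [MeasurableSpace Ω] (X : Interaction d T Γ S k m Ω)

lemma invNorm_sq {V : Matrix (Fin d) (Fin d) ℝ} (hV : V.PosDef) (x : Vec d) :
    invNorm V x ^ 2 = x.ofLp ⬝ᵥ (V⁻¹ *ᵥ x.ofLp) :=
  Real.sq_sqrt (by simpa using hV.inv.posSemidef.dotProduct_mulVec_nonneg x.ofLp)

/-- With u = V⁻¹x and y = xᵀu one has y ≤ ‖u‖ and l‖u‖² ≤ uᵀVu = y, hence ly² ≤ y. -/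
lemma invNorm_sq_le {A : Matrix (Fin d) (Fin d) ℝ} (hA : A.PosSemidef) {l : ℝ} (hl : 0 < l)
    (x : Vec d) (hx : ‖x‖ ≤ 1) :
    invNorm (A + l • (1 : Matrix (Fin d) (Fin d) ℝ)) x ^ 2 ≤ 1 / l := by
  have hV := posDef_add_smul_one hA hl
  set V := A + l • (1 : Matrix (Fin d) (Fin d) ℝ) with hVdef
  set u : Vec d := WithLp.toLp 2 (V⁻¹ *ᵥ x.ofLp) with hu
  have hVu : V *ᵥ u.ofLp = x.ofLp := by
    simp only [hu]
    rw [Matrix.mulVec_mulVec, Matrix.mul_nonsing_inv _ (isUnit_iff_ne_zero.2 hV.det_pos.ne'),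
      Matrix.one_mulVec]
  have h1 : invNorm V x ^ 2 = inner ℝ x u := by rw [invNorm_sq hV, inner_eq_dotProduct]
  have h2 := quad_add_smul_one A l u
  rw [← hVdef, hVu, dotProduct_comm, ← inner_eq_dotProduct, ← h1] at h2
  have h3 : 0 ≤ u.ofLp ⬝ᵥ (A *ᵥ u.ofLp) := by simpa using hA.dotProduct_mulVec_nonneg u.ofLp
  have h4 : invNorm V x ^ 2 ≤ ‖u‖ := by
    rw [h1]
    exact (real_inner_le_norm _ _).trans (mul_le_of_le_one_left (norm_nonneg _) hx)
  set y := invNorm V x ^ 2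
  have hy : 0 ≤ y := sq_nonneg _
  rw [le_div_iff₀ hl]
  by_contra hc
  push Not at hc
  have h5 : l * y ^ 2 ≤ y := by nlinarith [pow_le_pow_left₀ hy h4 2]
  have h6 : 0 < y := by
    by_contra h0
    have : y = 0 := le_antisymm (not_lt.1 h0) hy
    rw [this] at hc
    linarith
  nlinarith

/-- Discounting shrinks the regularizer as well; the last term restores it. -/
lemma V_succ {lam γ : ℝ} {t : ℕ} (ht : 1 ≤ t) (ω : Ω) :
    X.V lam γ (t + 1) ω = γ • X.V lam γ t ω
      + (1 : ℝ) • Matrix.vecMulVec (X.a t ω).ofLp (X.a t ω).ofLp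
      + ((1 - γ) * (lam / X.cμ)) • (1 : Matrix (Fin d) (Fin d) ℝ) := by
  unfold V
  rw [Finset.sum_Ico_succ_top ht, smul_add, Finset.smul_sum]
  have h1 : ∀ s ∈ Finset.Ico 1 t,
      γ ^ (t + 1 - 1 - s) • Matrix.vecMulVec (X.a s ω).ofLp (X.a s ω).ofLp
        = γ • γ ^ (t - 1 - s) • Matrix.vecMulVec (X.a s ω).ofLp (X.a s ω).ofLp := by
    intro s hs
    rw [Finset.mem_Ico] at hs
    rw [smul_smul, ← pow_succ']
    congr 2
    omega
  rw [Finset.sum_congr rfl h1, show t + 1 - 1 - t = 0 by omega, pow_zero]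
  module

/-- Log-determinants telescope. Omitting the restored regularizer can only lower the determinant,
and each discount by γ costs d log(1/γ). -/
lemma sum_log_le {lam γ : ℝ} (hlam : 0 < lam) (hγ0 : 0 < γ) (hγ1 : γ < 1) (ω : Ω) (n : ℕ) :
    ∑ t ∈ Finset.Ico 1 (n + 1), Real.log (1 + invNorm (X.V lam γ t ω) (X.a t ω) ^ 2)
      ≤ Real.log (X.V lam γ (n + 1) ω).det - d * Real.log (lam / X.cμ)
        + n * (d * Real.log (1 / γ)) := by
  have hc := X.toRewardModel.cμ_pos
  induction n with
  | zero => simp [V]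
  | succ n ih =>
    have h1 : 1 ≤ n + 1 := Nat.le_add_left 1 n
    have hV := X.posDef_V hlam hγ0.le (n + 1) ω
    set V := X.V lam γ (n + 1) ω
    set a := X.a (n + 1) ω
    have hγV : (γ • V).PosDef := hV.smul hγ0
    have hy := invNorm_sq hV a
    have hinv : (γ • V)⁻¹ = γ⁻¹ • V⁻¹ := by
      have := Matrix.inv_smul' V (Units.mk0 γ hγ0.ne') (isUnit_iff_ne_zero.2 hV.det_pos.ne')
      simpa [Units.smul_def] using this
    have hdet2 : (γ • V + (1 : ℝ) • Matrix.vecMulVec a.ofLp a.ofLp).det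
        = γ ^ d * V.det * (1 + γ⁻¹ * invNorm V a ^ 2) := by
      rw [det_add_smul_vecMulVec hγV, Matrix.det_smul, Fintype.card_fin, hinv,
        Matrix.smul_mulVec, dotProduct_smul, ← hy, smul_eq_mul, one_mul]
    have hpd : (γ • V + (1 : ℝ) • Matrix.vecMulVec a.ofLp a.ofLp).PosDef :=
      hγV.add_posSemidef ((posSemidef_vecMulVec _).smul zero_le_one)
    have hle := det_le_det_add_smul_one hpd (c := (1 - γ) * (lam / X.cμ))
      (mul_nonneg (by linarith) (by positivity))
    rw [← X.V_succ h1, hdet2] at hle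
    have hsq := sq_nonneg (invNorm V a)
    have hγi : 1 ≤ γ⁻¹ := (one_le_inv₀ hγ0).2 hγ1.le
    have hle2 : γ ^ d * V.det * (1 + invNorm V a ^ 2) ≤ (X.V lam γ (n + 1 + 1) ω).det := by
      refine le_trans (mul_le_mul_of_nonneg_left ?_
        (mul_nonneg (by positivity) hV.det_pos.le)) hle
      nlinarith
    have hdp := hV.det_pos
    have hlog := Real.log_le_log (by positivity) hle2
    rw [Real.log_mul (by positivity) (by positivity), Real.log_mul (by positivity) hdp.ne',
      Real.log_pow] at hlog
    rw [Finset.sum_Ico_succ_top h1]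
    have hγlog : Real.log (1 / γ) = -Real.log γ := by rw [one_div, Real.log_inv]
    rw [hγlog] at ih ⊢
    push_cast
    linarith

/-- Elliptical potential lemma with forgetting. -/
lemma sum_invNorm_le (hd : 1 ≤ d) {lam γ : ℝ} (hlam : 0 < lam) (hγ0 : 0 < γ) (hγ1 : γ < 1)
    (ω : Ω) :
    ∑ t ∈ Finset.Icc 1 T, invNorm (X.V lam γ t ω) (X.a t ω)
      ≤ Real.sqrt (d * T) * Real.sqrt (2 * max 1 (X.cμ / lam))
        * Real.sqrt (T * Real.log (1 / γ) + Real.log (1 + X.cμ / (d * lam * (1 - γ)))) := by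
  have hc := X.toRewardModel.cμ_pos
  have h1γ : 0 < 1 - γ := by linarith
  have hIcc : Finset.Icc 1 T = Finset.Ico 1 (T + 1) := by ext; simp [Finset.mem_Icc]
  have hterm : ∀ t ∈ Finset.Icc 1 T, invNorm (X.V lam γ t ω) (X.a t ω) ^ 2
      ≤ 2 * max 1 (X.cμ / lam) * Real.log (1 + invNorm (X.V lam γ t ω) (X.a t ω) ^ 2) := by
    intro t ht
    rw [Finset.mem_Icc] at ht
    refine le_two_mul_max_mul_log (sq_nonneg _) ?_
    have := invNorm_sq_le (posSemidef_gram (Finset.Ico 1 t) (fun s => γ ^ (t - 1 - s))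
      (fun s _ => pow_nonneg hγ0.le _) (fun s => X.a s ω)) (div_pos hlam hc) (X.a t ω)
      (X.norm_a_le ht.1 ht.2 ω)
    rwa [one_div_div] at this
  have htr : (gram (Finset.Ico 1 (T + 1)) (fun s => γ ^ (T + 1 - 1 - s)) fun s => X.a s ω).trace
      ≤ 1 / (1 - γ) := by
    rw [trace_gram]
    calc _ ≤ ∑ s ∈ Finset.Ico 1 (T + 1), γ ^ (T + 1 - 1 - s) := by
          refine Finset.sum_le_sum fun s hs => ?_
          rw [Finset.mem_Ico] at hs
          exact mul_le_of_le_one_right (by positivity)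
            (pow_le_one₀ (norm_nonneg _) (X.norm_a_le hs.1 (by omega) ω))
      _ = ∑ i ∈ Finset.range (T + 1 - 1), γ ^ i := sum_Ico_one_reflect (fun i => γ ^ i) (T + 1)
      _ ≤ 1 / (1 - γ) := by
          rw [geom_sum_eq hγ1.ne, ← neg_sub, ← neg_sub 1 γ, neg_div_neg_eq]
          refine div_le_div_of_nonneg_right ?_ h1γ.le
          have : 0 ≤ γ ^ (T + 1 - 1) := by positivity
          linarith
  have hdet := log_det_add_smul_one_le hd (posSemidef_gram (Finset.Ico 1 (T + 1))
    (fun s => γ ^ (T + 1 - 1 - s)) (fun s _ => pow_nonneg hγ0.le _) (fun s => X.a s ω))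
    (div_pos hlam hc) htr
  have hsum := X.sum_log_le hlam hγ0 hγ1 ω T
  rw [← X.V_eq_gram] at hdet
  have hd0 : (0 : ℝ) < d := by exact_mod_cast hd
  have hfrac : 1 / (1 - γ) / (d * (lam / X.cμ)) = X.cμ / (d * lam * (1 - γ)) := by field_simp
  rw [hfrac] at hdet
  set L := T * Real.log (1 / γ) + Real.log (1 + X.cμ / (d * lam * (1 - γ)))
  have hsq : ∑ t ∈ Finset.Icc 1 T, invNorm (X.V lam γ t ω) (X.a t ω) ^ 2
      ≤ 2 * max 1 (X.cμ / lam) * (d * L) := by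
    refine (Finset.sum_le_sum hterm).trans ?_
    rw [← Finset.mul_sum]
    refine mul_le_mul_of_nonneg_left ?_ (by positivity)
    rw [hIcc]
    simp only [L]
    linarith
  have hCS := sq_sum_le_card_mul_sum_sq (s := Finset.Icc 1 T)
    (f := fun t => invNorm (X.V lam γ t ω) (X.a t ω))
  rw [Nat.card_Icc, Nat.add_sub_cancel] at hCS
  rw [← Real.sqrt_mul (by positivity), ← Real.sqrt_mul (by positivity)]
  refine Real.le_sqrt_of_sq_le (hCS.trans ?_)
  calc _ ≤ (T : ℝ) * (2 * max 1 (X.cμ / lam) * (d * L)) :=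
        mul_le_mul_of_nonneg_left hsq (Nat.cast_nonneg _)
    _ = _ := by ring

/-! ### Counting the rounds that follow a change. -/

/-- Rounds at distance at most `D + 1` after a change of the parameter. -/
noncomputable def recentChange (D : ℕ) : Finset ℕ :=
  @Finset.filter ℕ (fun t => ∃ s, 1 ≤ s ∧ s < t ∧ t ≤ s + 1 + D ∧ X.θ (s + 1) ≠ X.θ s)
    (Classical.decPred _) (Finset.Icc 1 T)

lemma mem_recentChange {D t : ℕ} : t ∈ X.recentChange D ↔
    (1 ≤ t ∧ t ≤ T) ∧ ∃ s, 1 ≤ s ∧ s < t ∧ t ≤ s + 1 + D ∧ X.θ (s + 1) ≠ X.θ s := by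
  classical
  simp only [recentChange, Finset.mem_filter, Finset.mem_Icc]

/-- A change between s and s + 1 taints at most the D + 1 rounds s + 1, …, s + 1 + D. -/
lemma card_recentChange_le (D : ℕ) :
    (X.recentChange D).card
      ≤ {t : ℕ | 1 ≤ t ∧ t + 1 ≤ T ∧ X.θ (t + 1) ≠ X.θ t}.ncard * (D + 1) := by
  classical
  set C : Set ℕ := {t : ℕ | 1 ≤ t ∧ t + 1 ≤ T ∧ X.θ (t + 1) ≠ X.θ t}
  have hC : C.Finite := (Set.finite_Icc 1 T).subset fun t ht => ⟨ht.1, by have := ht.2.1; omega⟩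
  have hsub : X.recentChange D ⊆ hC.toFinset.biUnion fun s => Finset.Icc (s + 1) (s + 1 + D) := by
    intro t ht
    rw [mem_recentChange] at ht
    obtain ⟨⟨h1, h2⟩, s, hs1, hst, hts, hne⟩ := ht
    rw [Finset.mem_biUnion]
    refine ⟨s, ?_, ?_⟩
    · rw [Set.Finite.mem_toFinset]
      exact ⟨hs1, by omega, hne⟩
    · rw [Finset.mem_Icc]; omega
  refine (Finset.card_le_card hsub).trans ?_
  rw [Set.ncard_eq_toFinset_card C hC]
  refine Finset.card_biUnion_le_card_mul _ _ _ fun s _ => ?_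
  rw [Nat.card_Icc]
  omega

/-- Any change inside the window would itself witness membership in `recentChange`. -/
lemma θ_eq_of_notMem_recentChange {D t : ℕ} (ht1 : 1 ≤ t) (ht : t ≤ T)
    (h : t ∉ X.recentChange D) {s : ℕ} (hs : 1 ≤ s) (hst : s ≤ t) (hD : t ≤ s + 1 + D) :
    X.θ s = X.θ t := by
  have hno : ∀ s', s ≤ s' → s' < t → X.θ (s' + 1) = X.θ s' := by
    intro s' h1 h2
    by_contra hne
    refine h ((X.mem_recentChange).2 ?_)
    exact ⟨⟨ht1, ht⟩, s', by omega, h2, by omega, hne⟩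
  have key : ∀ n, s + n ≤ t → X.θ (s + n) = X.θ s := by
    intro n
    induction n with
    | zero => simp
    | succ n ih =>
      intro hn
      rw [← add_assoc, hno (s + n) (by omega) (by omega)]
      exact ih (by omega)
  have := key (t - s) (by omega)
  rw [Nat.add_sub_cancel' hst] at this
  exact this.symm

end Interaction

/-! ### The high-probability regret bound. -/

namespace Interaction

variable {d T Γ : ℕ} {S k m : ℝ} {Ω : Type*} [MeasurableSpace Ω] (X : Interaction d T Γ S k m Ω)

/-- Allows θ_t to replace θ_s in every sum weighted by `w`, so that residuals relative to θ_t are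
true noise there. -/
lemma weight_eq_zero_or_θ_eq {D : ℕ} {w : ℕ → ℝ} (hwD : ∀ i, D < i → w i = 0) {t : ℕ} (ht1 : 1 ≤ t)
    (ht : t ≤ T) (hgood : t ∉ X.recentChange D) {s : ℕ} (hs : s ∈ Finset.Ico 1 t) :
    w (t - 1 - s) = 0 ∨ X.θ s = X.θ t := by
  rw [Finset.mem_Ico] at hs
  by_cases h : D < t - 1 - s
  · exact Or.inl (hwD _ h)
  · exact Or.inr (X.θ_eq_of_notMem_recentChange ht1 ht hgood hs.1 hs.2.le (by omega))

/-- With high probability the confidence bound holds at all rounds without recent change. -/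
theorem confidence_withHighProb (hd : 1 ≤ d) (hT : 1 ≤ T) (hm : 0 < m) {lam γ δ : ℝ}
    (hlam : 0 < lam) (hγ : 1 / 2 < γ) (hγ1 : γ < 1) (hδ : 0 < δ) (hδ1 : δ ≤ 1)
    {D : ℕ} {w : ℕ → ℝ} (hw : ∀ i, 0 ≤ w i ∧ w i ≤ γ ^ i) (hwD : ∀ i, D < i → w i = 0)
    (hw2 : ∀ n, ∑ i ∈ Finset.range n, w i ^ 2 ≤ (1 - ((T : ℝ) ^ 2)⁻¹) / (1 - γ ^ 2))
    (hwb : ∀ n, ∑ i ∈ Finset.range n, (γ ^ i - w i) ≤ 1 / (T * (1 - γ))) :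
    X.WithHighProb δ fun ω => ∀ t, 1 ≤ t → t ≤ T → t ∉ X.recentChange D → ∀ θ' : Vec d,
      IsMinOn (X.loss lam γ t ω) Set.univ θ' →
      ∑ s ∈ Finset.Ico 1 t, γ ^ (t - 1 - s) * deriv X.μ (inner ℝ (X.a s ω) (X.θ t))
        * inner ℝ (X.a s ω) (θ' - X.θ t) ^ 2 + lam * ‖θ' - X.θ t‖ ^ 2
      ≤ lam * widthBase d T S k m lam γ δ ^ 3 := by
  have hTpos : (0 : ℝ) < T := by exact_mod_cast hT
  have hS := X.radius_nonneg hT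
  have hk : 0 ≤ k := X.toRewardModel.cμ_pos.le.trans (X.toRewardModel.cμ_le hS)
  have hγ0 : 0 < γ := by linarith
  have h1γ : 0 < 1 - γ := by linarith
  have hw1 : ∀ i, |w i| ≤ 1 := fun i => by
    rw [abs_of_nonneg (hw i).1]
    exact (hw i).2.trans (pow_le_one₀ hγ0.le hγ1.le)
  have hρ := rho_nonneg (d := d) hT hk hm hlam hγ0 hγ1 hδ hδ1
  -- The weights depend on t, so concentration is applied at each round with δ/T; this yields the
  -- log(T/δ) of ρ. Indices outside 1, …, T get the empty event, so that `choose` runs over all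
  -- naturals.
  have hev : ∀ t : ℕ, ∃ E : Set Ω, MeasurableSet E ∧ X.P E ≤ ENNReal.ofReal (δ / T) ∧
      (1 ≤ t → t ≤ T → ∀ ω ∉ E, ∀ Δ : Vec d,
        ∑ s ∈ Finset.Ico 1 t, w (t - 1 - s) * X.noise s ω * inner ℝ (X.a s ω) Δ ≤
        rho d T k m lam γ δ *
        Real.sqrt (∑ s ∈ Finset.Ico 1 t, w (t - 1 - s) ^ 2 * deriv X.μ (X.param s ω)
            * inner ℝ (X.a s ω) Δ ^ 2 + lam * ‖Δ‖ ^ 2)) := by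
    intro t
    by_cases ht : 1 ≤ t ∧ t ≤ T
    · obtain ⟨E, hE1, hE2, hE3⟩ := X.self_normalized_concentration hd hm hlam
        (div_pos hδ hTpos) (v := fun s => w (t - 1 - s)) (fun s => hw1 _) ht.1 ht.2
        (τ := k * ((1 - ((T : ℝ) ^ 2)⁻¹) / (1 - γ ^ 2))) (by
          rw [sum_Ico_one_reflect (fun i => w i ^ 2)]
          exact mul_le_mul_of_nonneg_left (hw2 _) hk)
      refine ⟨E, hE1, hE2, fun _ _ ω hω Δ => (hE3 ω hω Δ).trans (le_of_eq ?_)⟩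
      congr 1
      rw [one_div_div, mul_div_assoc', div_div, mul_comm (1 - γ ^ 2), rho]
      ring
    · exact ⟨∅, MeasurableSet.empty, by simp, fun h1 h2 => absurd ⟨h1, h2⟩ ht⟩
  choose E hEm hEP hE using hev
  set F : Set Ω := ⋂ t ∈ Finset.Icc 1 T, {ω | 0 ≤ X.r (t + 1) ω ∧ X.r (t + 1) ω ≤ m}
  have hFm : MeasurableSet F := by
    refine Finset.measurableSet_biInter _ fun t ht => ?_
    rw [Finset.mem_Icc] at ht
    have hr := (X.measurable_r t ht.1 ht.2).mono (X.ℱ.le _) le_rfl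
    exact (measurableSet_le measurable_const hr).inter (measurableSet_le hr measurable_const)
  have hFae : ∀ᵐ ω ∂X.P, ω ∈ F := by
    simp only [F, Set.mem_iInter, Set.mem_ofPred_eq]
    rw [Finset.eventually_all]
    intro t ht
    rw [Finset.mem_Icc] at ht
    exact X.r_bounded t ht.1 ht.2
  set U : Set Ω := ⋃ t ∈ Finset.Icc 1 T, E t
  have hUm : MeasurableSet U := Finset.measurableSet_biUnion _ fun t _ => hEm t
  have hUP : X.P U ≤ ENNReal.ofReal δ := by
    calc X.P U ≤ ∑ t ∈ Finset.Icc 1 T, X.P (E t) := measure_biUnion_finset_le _ _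
      _ ≤ ∑ t ∈ Finset.Icc 1 T, ENNReal.ofReal (δ / T) := Finset.sum_le_sum fun t _ => hEP t
      _ = ENNReal.ofReal δ := by
          rw [Finset.sum_const, Nat.card_Icc, Nat.add_sub_cancel, nsmul_eq_mul,
            ← ENNReal.ofReal_natCast, ← ENNReal.ofReal_mul (Nat.cast_nonneg _),
            mul_div_cancel₀ _ hTpos.ne']
  refine ⟨Uᶜ ∩ F, hUm.compl.inter hFm, ?_, ?_⟩
  · have h1 : X.P.real (Uᶜ ∩ F) = X.P.real Uᶜ := by
      refine measureReal_congr ?_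
      filter_upwards [hFae] with ω hω
      exact propext ⟨fun h => h.1, fun h => ⟨h, hω⟩⟩
    rw [h1, probReal_compl_eq_one_sub hUm]
    have : X.P.real U ≤ δ := ENNReal.toReal_le_of_le_ofReal hδ.le hUP
    linarith
  · rintro ω ⟨hωU, hωF⟩ t ht1 ht hgood θ' hmin
    have hωE : ω ∉ E t := fun h => hωU (Set.mem_biUnion (Finset.mem_Icc.2 ⟨ht1, ht⟩) h)
    have hc := hE t ht1 ht ω hωE (θ' - X.θ t)
    have hI : ∀ s ∈ Finset.Ico 1 t, 1 ≤ s ∧ s ≤ T := fun s hs => by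
      rw [Finset.mem_Ico] at hs; omega
    refine confidence_of_self_normalized (r := fun s => X.r (s + 1) ω) (m := m) (S := S)
      (v := fun s => w (t - 1 - s))
      X.toRewardModel.differentiable_μ X.differentiable_slope X.selfConcordant hlam hρ
      (fun s _ => (hw _).1) (fun s _ => (hw _).2) (fun s _ => pow_le_one₀ hγ0.le hγ1.le)
      (fun s hs => X.norm_a_le (hI s hs).1 (hI s hs).2 ω) (X.norm_θ_le t ht1 ht)
      (X.loss_first_order hmin) (fun s hs => ?_) ?_ (radius_le_Sbar hS hk hm hlam hγ1) ?_
    · have h1 := X.μ_mem_Icc hT (inner ℝ (X.a s ω) (X.θ t))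
      have h2 := Set.mem_iInter₂.1 hωF s (Finset.mem_Icc.2 (hI s hs))
      rw [abs_le]
      constructor <;> linarith [h1.1, h1.2, h2.1, h2.2]
    -- Only the m in the numerator of S̄ − S is needed; 2Sk is slack.
    · rw [sum_Ico_one_reflect (fun i => γ ^ i - w i)]
      calc _ ≤ 1 / (T * (1 - γ)) * m := mul_le_mul_of_nonneg_right (hwb _) hm.le
        _ ≤ 1 / (T * (1 - γ)) * (2 * S * k + m) := by
            refine mul_le_mul_of_nonneg_left ?_ (by positivity)
            have : 0 ≤ 2 * S * k := by positivity
            linarith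
        _ = _ := by
            rw [Sbar, add_sub_cancel_left]
            field_simp
    · have e1 : ∑ s ∈ Finset.Ico 1 t, w (t - 1 - s) * (X.r (s + 1) ω
          - X.μ (inner ℝ (X.a s ω) (X.θ t))) * inner ℝ (X.a s ω) (θ' - X.θ t)
          = ∑ s ∈ Finset.Ico 1 t, w (t - 1 - s) * X.noise s ω
            * inner ℝ (X.a s ω) (θ' - X.θ t) := by
        refine Finset.sum_congr rfl fun s hs => ?_
        rcases X.weight_eq_zero_or_θ_eq hwD ht1 ht hgood hs with h | h
        · simp [h]
        · simp only [noise, param, h]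
      have e2 : ∑ s ∈ Finset.Ico 1 t, w (t - 1 - s) ^ 2
            * deriv X.μ (inner ℝ (X.a s ω) (X.θ t)) * inner ℝ (X.a s ω) (θ' - X.θ t) ^ 2
          = ∑ s ∈ Finset.Ico 1 t, w (t - 1 - s) ^ 2 * deriv X.μ (X.param s ω)
            * inner ℝ (X.a s ω) (θ' - X.θ t) ^ 2 := by
        refine Finset.sum_congr rfl fun s hs => ?_
        rcases X.weight_eq_zero_or_θ_eq hwD ht1 ht hgood hs with h | h
        · simp [h]
        · simp only [param, h]
      have hc' := hc
      rw [← e1, ← e2] at hc'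
      exact hc'

lemma beta_nonneg {lam γ δ : ℝ} (X : Interaction d T Γ S k m Ω) (hT : 1 ≤ T) (hlam : 0 < lam)
    (hm : 0 < m) (hγ0 : 0 < γ) (hγ1 : γ < 1) (hδ : 0 < δ) (hδ1 : δ ≤ 1) :
    0 ≤ beta d T S k m lam γ δ := by
  have hS := X.radius_nonneg hT
  have hk : 0 ≤ k := X.toRewardModel.cμ_pos.le.trans (X.toRewardModel.cμ_le hS)
  rw [beta_eq_sqrt hlam (zero_le_one.trans
    (one_le_widthBase hS hT hk hm hlam hγ0 hγ1 hδ hδ1))]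
  positivity

/-- The total cost of the rounds that follow a change. -/
lemma cost_recentChange_le (hm : 0 < m) {γ : ℝ} (hγ1 : γ < 1) {D : ℕ}
    (hD : 2 ≤ T → (D : ℝ) + 1 ≤ 2 * Real.log T / (1 - γ)) :
    (X.recentChange D).card * m ≤ 2 * m * Real.log T * Γ / (1 - γ) := by
  have h1γ : 0 < 1 - γ := by linarith
  by_cases hT : 2 ≤ T
  · have h1 := (X.card_recentChange_le D).trans (Nat.mul_le_mul_right (D + 1) X.changes_le)
    have h2 : ((X.recentChange D).card : ℝ) ≤ Γ * (D + 1) := by exact_mod_cast h1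
    calc _ ≤ Γ * (2 * Real.log T / (1 - γ)) * m :=
          mul_le_mul_of_nonneg_right
            (h2.trans (mul_le_mul_of_nonneg_left (hD hT) (Nat.cast_nonneg _))) hm.le
      _ = _ := by ring
  -- For T ≤ 1 the bound on D is unavailable, but no change can precede a round.
  · have h0 : X.recentChange D = ∅ := by
      refine Finset.eq_empty_of_forall_notMem fun t ht => ?_
      rw [mem_recentChange] at ht
      obtain ⟨⟨h1, h2⟩, s, h3, h4, -⟩ := ht
      omega
    rw [h0, Finset.card_empty, Nat.cast_zero, zero_mul]
    have : 0 ≤ Real.log T := Real.log_natCast_nonneg T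
    positivity

/-- High-probability regret bound for D-GLUCB. -/
theorem regret_withHighProb (hd : 1 ≤ d) (hT : 1 ≤ T) (hm : 0 < m) {lam γ δ : ℝ}
    (hlam : 0 < lam) (hγ : 1 / 2 < γ) (hγ1 : γ < 1) (hδ : 0 < δ) (hδ1 : δ ≤ 1)
    (hX : X.IsDGLUCB lam γ δ) :
    X.WithHighProb δ fun ω => X.regret ω ≤
      2 * m * Real.log T * Γ / (1 - γ)
        + 2 * beta d T S k m lam γ δ / Real.sqrt X.cμ * Real.sqrt (d * T)
          * Real.sqrt (2 * max 1 (X.cμ / lam))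
          * Real.sqrt (T * Real.log (1 / γ) + Real.log (1 + X.cμ / (d * lam * (1 - γ)))) := by
  classical
  have hγ0 : 0 < γ := by linarith
  obtain ⟨D, w, hw, hwD, hw2, hwb, hD⟩ := exists_window_weights hγ hγ1 hT
  obtain ⟨θhat, hθ⟩ := hX
  obtain ⟨G, hGm, hGP, hG⟩ :=
    X.confidence_withHighProb hd hT hm hlam hγ hγ1 hδ hδ1 hw hwD hw2 hwb
  refine ⟨G, hGm, hGP, fun ω hω => ?_⟩
  have hβ := X.beta_nonneg hT hlam hm hγ0 hγ1 hδ hδ1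
  set B := beta d T S k m lam γ δ / Real.sqrt X.cμ
  have hB : 0 ≤ B := div_nonneg hβ (Real.sqrt_nonneg _)
  have hround : ∀ t ∈ Finset.Icc 1 T,
      sSup ((fun x : Vec d => X.μ (inner ℝ x (X.θ t))) '' X.A t ω)
        - X.μ (inner ℝ (X.a t ω) (X.θ t))
      ≤ (if t ∈ X.recentChange D then m else 0)
        + 2 * B * invNorm (X.V lam γ t ω) (X.a t ω) := by
    intro t ht
    rw [Finset.mem_Icc] at ht
    have hinv : 0 ≤ invNorm (X.V lam γ t ω) (X.a t ω) := Real.sqrt_nonneg _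
    by_cases hb : t ∈ X.recentChange D
    · rw [if_pos hb]
      have := X.instant_regret_le ht.1 ht.2 ω
      have h2 : 0 ≤ 2 * B * invNorm (X.V lam γ t ω) (X.a t ω) := by positivity
      linarith
    · rw [if_neg hb, zero_add]
      obtain ⟨hmin, hmax⟩ := hθ t ht.1 ht.2 ω
      exact X.instant_regret_le_of_prediction_error ht.1 ht.2
        (X.prediction_error_le hlam hγ0 hγ1 hm hδ hδ1 ht.1 ht.2
          (hG ω hω t ht.1 ht.2 hb _ hmin)) hmax
  have hcost := X.cost_recentChange_le hm hγ1 hD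
  have hpot := X.sum_invNorm_le hd hlam hγ0 hγ1 ω
  have hsub : X.recentChange D ⊆ Finset.Icc 1 T := fun t ht => by
    rw [mem_recentChange] at ht
    exact Finset.mem_Icc.2 ht.1
  calc X.regret ω ≤ ∑ t ∈ Finset.Icc 1 T, ((if t ∈ X.recentChange D then m else 0)
        + 2 * B * invNorm (X.V lam γ t ω) (X.a t ω)) := Finset.sum_le_sum hround
    _ = (X.recentChange D).card * m
        + 2 * B * ∑ t ∈ Finset.Icc 1 T, invNorm (X.V lam γ t ω) (X.a t ω) := by
        rw [Finset.sum_add_distrib, ← Finset.mul_sum, Finset.sum_ite_mem,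
          Finset.inter_eq_right.2 hsub, Finset.sum_const, nsmul_eq_mul]
    _ ≤ _ := by
        refine (add_le_add hcost (mul_le_mul_of_nonneg_left hpot (by positivity))).trans
          (le_of_eq ?_)
        simp only [B]
        ring

/-- The regret is at most `m` per round. -/
lemma regret_le (ω : Ω) : X.regret ω ≤ m * T := by
  calc X.regret ω ≤ ∑ _t ∈ Finset.Icc 1 T, m := Finset.sum_le_sum fun t ht => by
        rw [Finset.mem_Icc] at ht
        exact X.instant_regret_le ht.1 ht.2 ω
    _ = m * T := by rw [Finset.sum_const, Nat.card_Icc, Nat.add_sub_cancel, nsmul_eq_mul, mul_comm]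

lemma WithHighProb.mono {X : Interaction d T Γ S k m Ω} {δ : ℝ} {Q R : Ω → Prop}
    (h : X.WithHighProb δ Q) (hQR : ∀ ω, Q ω → R ω) : X.WithHighProb δ R := by
  obtain ⟨G, h1, h2, h3⟩ := h
  exact ⟨G, h1, h2, fun ω hω => hQR ω (h3 ω hω)⟩

end Interaction

/-! ### Replacing cμ by k in the potential term. -/

/-- Bernoulli's inequality: 1 + Kx ≤ (1 + x)^max(1, K). -/
lemma log_one_add_mul_le {x K : ℝ} (hx : 0 ≤ x) (hK : 0 ≤ K) :
    Real.log (1 + K * x) ≤ max 1 K * Real.log (1 + x) := by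
  have h1 : 1 ≤ max 1 K := le_max_left _ _
  have h2 := one_add_mul_self_le_rpow_one_add (by linarith : -1 ≤ x) h1
  have h3 : 1 + K * x ≤ (1 + x) ^ max 1 K := by
    have := mul_le_mul_of_nonneg_right (le_max_right 1 K) hx
    linarith
  have h4 := Real.log_le_log (by positivity) h3
  rwa [Real.log_rpow (by linarith)] at h4

/-- The bound with factors depending on `k` instead of `c_μ`. -/
lemma width_term_le {d T : ℕ} {k lam γ c : ℝ} (hc : 0 < c) (hck : c ≤ k)
    (hlam : 0 < lam) (hγ0 : 0 < γ) (hγ1 : γ < 1) :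
    Real.sqrt (2 * max 1 (c / lam))
        * Real.sqrt (T * Real.log (1 / γ) + Real.log (1 + c / (d * lam * (1 - γ))))
      ≤ Real.sqrt (2 * max 1 (k / lam) * max 1 k)
        * Real.sqrt (T * Real.log (1 / γ) + Real.log (1 + 1 / (d * lam * (1 - γ)))) := by
  have h1γ : 0 < 1 - γ := by linarith
  have hk : 0 < k := hc.trans_le hck
  rw [← Real.sqrt_mul (by positivity), ← Real.sqrt_mul (by positivity)]
  refine Real.sqrt_le_sqrt ?_
  have hl : 0 ≤ Real.log (1 / γ) := Real.log_nonneg (by rw [le_div_iff₀ hγ0]; linarith)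
  set x := 1 / (d * lam * (1 - γ))
  have hx : 0 ≤ x := by positivity
  have hcx : c / (d * lam * (1 - γ)) = c * x := by rw [div_eq_mul_one_div]
  have h1 : Real.log (1 + c * x) ≤ max 1 k * Real.log (1 + x) := by
    refine le_trans (Real.log_le_log (by positivity) ?_) (log_one_add_mul_le hx hk.le)
    have := mul_le_mul_of_nonneg_right hck hx
    linarith
  have h2 : T * Real.log (1 / γ) ≤ max 1 k * (T * Real.log (1 / γ)) :=
    le_mul_of_one_le_left (by positivity) (le_max_left _ _)
  have h3 : max 1 (c / lam) ≤ max 1 (k / lam) :=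
    max_le_max le_rfl (div_le_div_of_nonneg_right hck hlam.le)
  rw [hcx, mul_assoc (2 * _)]
  have h4 : 0 ≤ Real.log (1 + x) := Real.log_nonneg (by linarith)
  refine mul_le_mul (by linarith) (by linarith) ?_ (by positivity)
  have : 0 ≤ Real.log (1 + c * x) := Real.log_nonneg (by nlinarith [mul_nonneg hc.le hx])
  positivity

/-! ### Evaluation at the tuned parameters. -/

/-- The order of magnitude of the tuned regret bound. -/
noncomputable def rateBound (c d Γ T : ℝ) : ℝ :=
  c ^ (-(1 / 3) : ℝ) * d ^ (2 / 3 : ℝ) * Γ ^ (1 / 3 : ℝ) * T ^ (2 / 3 : ℝ)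

/-- The rate and the tuning involve exponents in thirds; they are compared through their cubes,
which are rational expressions. -/
lemma rpow_div_three_pow_three {x : ℝ} (hx : 0 ≤ x) (y : ℝ) : (x ^ (y / 3)) ^ 3 = x ^ y := by
  rw [← Real.rpow_natCast, ← Real.rpow_mul hx]
  norm_num

lemma rateBound_nonneg {c d Γ T : ℝ} (hc : 0 < c) (hd : 0 < d) (hΓ : 0 ≤ Γ) (hT : 0 < T) :
    0 ≤ rateBound c d Γ T := by
  unfold rateBound
  positivity

lemma rateBound_pow_three {c d Γ T : ℝ} (hc : 0 < c) (hd : 0 < d) (hΓ : 0 ≤ Γ) (hT : 0 < T) :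
    rateBound c d Γ T ^ 3 = d ^ 2 * Γ * T ^ 2 / c := by
  rw [rateBound, mul_pow, mul_pow, mul_pow, ← neg_div, rpow_div_three_pow_three hc.le,
    rpow_div_three_pow_three hd.le, rpow_div_three_pow_three hΓ, rpow_div_three_pow_three hT.le,
    Real.rpow_neg_one, Real.rpow_one, Real.rpow_two, Real.rpow_two]
  field_simp

lemma tuning_pow_three {c d Γ T η : ℝ} (hc : 0 < c) (hd : 0 < d) (hΓ : 0 ≤ Γ) (hT : 0 < T)
    (hη : η = (c ^ (1 / 2 : ℝ) * Γ / (d * T)) ^ (2 / 3 : ℝ)) :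
    η ^ 3 = c * Γ ^ 2 / (d * T) ^ 2 := by
  rw [hη, rpow_div_three_pow_three (by positivity), Real.rpow_two, div_pow, mul_pow,
    ← Real.sqrt_eq_rpow, Real.sq_sqrt hc.le]

lemma log_one_add_two_mul_le {k T L : ℝ} (hk : 0 ≤ k) (hT : 1 ≤ T) (hL : Real.log T ≤ L)
    (hL2 : 1 / 2 ≤ L) : Real.log (1 + 2 * k * T) ≤ (4 * k + 1) * L := by
  have h1 : Real.log (1 + 2 * k * T) ≤ Real.log ((1 + 2 * k) * T) :=
    Real.log_le_log (by positivity) (by nlinarith)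
  rw [Real.log_mul (by positivity) (by positivity)] at h1
  have h2 := Real.log_le_sub_one_of_pos (show 0 < 1 + 2 * k by positivity)
  nlinarith [mul_nonneg hk (sub_nonneg.2 hL2)]

/-- The logarithm of an information gain is controlled by `L` for the tuned parameters. -/
lemma log_information_le {k T L d lam η x y : ℝ} (hk : 0 ≤ k) (hT : 1 ≤ T)
    (hL : Real.log T ≤ L) (hL2 : 1 / 2 ≤ L) (hd : 1 ≤ d) (hlam : 1 / 2 ≤ lam) (hη : 0 < η)
    (hTη : 1 ≤ T * η) (hx0 : 0 ≤ x) (hx : x ≤ k) (hy : η ≤ y) :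
    Real.log (1 + x / (d * lam * y)) ≤ (4 * k + 1) * L := by
  have hd0 : 0 < d := by linarith
  have hlam0 : 0 < lam := by linarith
  have hy0 : 0 < y := hη.trans_le hy
  refine le_trans (Real.log_le_log (by positivity) ?_) (log_one_add_two_mul_le hk hT hL hL2)
  · have hdl : 1 / 2 ≤ d * lam := by nlinarith
    have hden : η / 2 ≤ d * lam * y := by nlinarith
    have h1 : x / (d * lam * y) ≤ k / (η / 2) := div_le_div₀ hk hx (by positivity) hden
    have h2 : k / (η / 2) ≤ 2 * k * T := by
      rw [div_le_iff₀ (by positivity)]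
      nlinarith
    linarith

/-- λ = d log T gives d/λ = 1/log T ≤ 2, which removes the dimension from ρ/√λ. -/
lemma rho_div_sqrt_le {d T : ℕ} {k m lam γ δ L : ℝ} (hd : 1 ≤ d) (hT : 2 ≤ T) (hk : 0 ≤ k)
    (hm : 0 < m) (hγ0 : 0 < γ) (hγ1 : γ < 1)
    (hlam : lam = d * Real.log T) (hL : L = Real.log (T / δ)) (hLT : Real.log T ≤ L)
    (hTη : 1 ≤ T * (1 - γ)) :
    rho d T k m lam γ δ / Real.sqrt lam ≤ (1 / m + 8 * m + 2 * m * (4 * k + 1)) * L := by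
  have hd1 : (1 : ℝ) ≤ d := by exact_mod_cast hd
  have hd0 : (0 : ℝ) < d := by linarith
  have hT2 : (2 : ℝ) ≤ T := by exact_mod_cast hT
  have hlog2 : Real.log 2 ≤ Real.log T := Real.log_le_log (by norm_num) hT2
  have hlog2' : 1 / 2 ≤ Real.log 2 := by linarith [Real.log_two_gt_d9]
  have hℓ : 1 / 2 ≤ Real.log T := hlog2'.trans hlog2
  have hlam2 : 1 / 2 ≤ lam := by rw [hlam]; nlinarith
  have hlam0 : 0 < lam := by linarith
  have hL2 : 1 / 2 ≤ L := hℓ.trans hLT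
  have hw := Real.mul_self_sqrt hlam0.le
  have hw0 : Real.sqrt lam ≠ 0 := (Real.sqrt_pos.2 hlam0).ne'
  have hTi : ((T : ℝ) ^ 2)⁻¹ ≤ 1 := inv_le_one_of_one_le₀ (one_le_pow₀ (by linarith))
  have hTi0 : 0 ≤ ((T : ℝ) ^ 2)⁻¹ := by positivity
  set Λ := Real.log (1 + k * (1 - ((T : ℝ) ^ 2)⁻¹) / (d * lam * (1 - γ ^ 2))) with hΛ
  have hΛL : Λ ≤ (4 * k + 1) * L :=
    log_information_le hk (by linarith) hLT hL2 hd1 hlam2 (by linarith) hTη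
      (mul_nonneg hk (by linarith)) (by nlinarith) (by nlinarith)
  have e : rho d T k m lam γ δ / Real.sqrt lam
      = 1 / (2 * m) + 2 * m / lam * L + 2 * m * (Real.log 2 / Real.log T) + m / Real.log T * Λ := by
    have hlamd : (d : ℝ) / lam = 1 / Real.log T := by rw [hlam]; field_simp
    have e1 : rho d T k m lam γ δ / Real.sqrt lam
        = 1 / (2 * m) + 2 * m / lam * L + 2 * m * (d / lam) * Real.log 2 + m * (d / lam) * Λ := by
      rw [rho, ← hL, ← hΛ]
      field_simp
      rw [Real.sq_sqrt hlam0.le]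
      ring
    rw [e1, hlamd]
    ring
  have h1 : 1 / (2 * m) ≤ 1 / m * L := by
    have : 1 / (2 * m) = 1 / m * (1 / 2) := by ring
    rw [this]
    exact mul_le_mul_of_nonneg_left hL2 (by positivity)
  have h2 : 2 * m / lam * L ≤ 4 * m * L := by
    refine mul_le_mul_of_nonneg_right ?_ (by linarith)
    rw [div_le_iff₀ hlam0]
    nlinarith
  have h3 : 2 * m * (Real.log 2 / Real.log T) ≤ 4 * m * L := by
    have : Real.log 2 / Real.log T ≤ 1 := (div_le_one (by linarith)).2 hlog2
    nlinarith
  have h4 : m / Real.log T * Λ ≤ 2 * m * ((4 * k + 1) * L) := by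
    have h5 : m / Real.log T ≤ 2 * m := by
      rw [div_le_iff₀ (by linarith)]
      nlinarith
    have h6 : 0 ≤ (4 * k + 1) * L := by nlinarith
    exact (mul_le_mul_of_nonneg_left hΛL (by positivity)).trans
      (mul_le_mul_of_nonneg_right h5 h6)
  rw [e]
  linarith

/-- Tλ(1 − γ) ≥ 1/2 bounds S̄ by a constant depending on S, k, m. The cross term is absorbed by the
two squares, and 4L² ≥ 1 turns constants into multiples of L². -/
lemma widthBase_le {d T : ℕ} {S k m lam γ δ L : ℝ} (hd : 1 ≤ d) (hT : 2 ≤ T) (hS : 0 ≤ S)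
    (hk : 0 ≤ k) (hm : 0 < m) (hγ0 : 0 < γ) (hγ1 : γ < 1) (hδ : 0 < δ) (hδ1 : δ ≤ 1)
    (hlam : lam = d * Real.log T) (hL : L = Real.log (T / δ)) (hLT : Real.log T ≤ L)
    (hTη : 1 ≤ T * (1 - γ)) :
    widthBase d T S k m lam γ δ ≤ (8 * (1 + (S + 2 * (2 * S * k + m)))
      + 2 * (1 / m + 8 * m + 2 * m * (4 * k + 1)) ^ 2) * L ^ 2 := by
  have hd1 : (1 : ℝ) ≤ d := by exact_mod_cast hd
  have hT2 : (2 : ℝ) ≤ T := by exact_mod_cast hT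
  have hlog2 : Real.log 2 ≤ Real.log T := Real.log_le_log (by norm_num) hT2
  have hℓ : 1 / 2 ≤ Real.log T := by linarith [Real.log_two_gt_d9]
  have hlam2 : 1 / 2 ≤ lam := by rw [hlam]; nlinarith
  have hlam0 : 0 < lam := by linarith
  have hL2 : 1 / 2 ≤ L := hℓ.trans hLT
  have hq := rho_div_sqrt_le (δ := δ) hd hT hk hm hγ0 hγ1 hlam hL hLT hTη
  have hρ0 := rho_nonneg (d := d) (by omega : 1 ≤ T) hk hm hlam0 hγ0 hγ1 hδ hδ1
  set Cq := 1 / m + 8 * m + 2 * m * (4 * k + 1)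
  set q := rho d T k m lam γ δ / Real.sqrt lam with hqdef
  have hq0 : 0 ≤ q := by positivity
  have hSk : 0 ≤ 2 * S * k + m := by positivity
  have hSbar : Sbar T S k m lam γ ≤ S + 2 * (2 * S * k + m) := by
    rw [Sbar]
    have h1 : 1 / 2 ≤ T * lam * (1 - γ) := by nlinarith
    have : (2 * S * k + m) / (T * lam * (1 - γ)) ≤ 2 * (2 * S * k + m) := by
      rw [div_le_iff₀ (by linarith)]
      nlinarith
    linarith
  have hS0 := hS.trans (radius_le_Sbar (T := T) hS hk hm hlam0 hγ1)
  set s := 1 + Sbar T S k m lam γ with hs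
  have hs0 : 0 ≤ s := by linarith
  have hsq : Real.sqrt (s / lam) * rho d T k m lam γ δ = Real.sqrt s * q := by
    rw [Real.sqrt_div hs0, hqdef]
    ring
  have hW : widthBase d T S k m lam γ δ ≤ 2 * s + 2 * q ^ 2 := by
    rw [widthBase, ← hs, hsq, ← hqdef]
    nlinarith [sq_nonneg (Real.sqrt s - q), Real.sq_sqrt hs0]
  have hL4 : 1 ≤ 4 * L ^ 2 := by nlinarith
  have hq2 : q ^ 2 ≤ Cq ^ 2 * L ^ 2 := by
    rw [← mul_pow]
    exact pow_le_pow_left₀ hq0 hq 2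
  have hs2 : s ≤ (1 + (S + 2 * (2 * S * k + m))) * (4 * L ^ 2) :=
    (by linarith : s ≤ 1 + (S + 2 * (2 * S * k + m))).trans
      (le_mul_of_one_le_right (by positivity) hL4)
  linarith

/-- The constant in the tuned rate. -/
noncomputable def rateConst (S k m : ℝ) : ℝ :=
  16 * m + Real.sqrt (8 * k ^ 2 * (1 + 2 * k) * (4 * k + 5)
    * (8 * (1 + (S + 2 * (2 * S * k + m)))
      + 2 * (1 / m + 8 * m + 2 * m * (4 * k + 1)) ^ 2) ^ 3)

/-- Deterministic evaluation of the regret bound at the tuned parameters. -/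
lemma bound_le_rate {d T Γ : ℕ} {S k m lam γ δ c R : ℝ} (hd : 1 ≤ d) (hT : 2 ≤ T) (hS : 0 ≤ S)
    (hm : 0 < m) (hγ : 1 / 2 < γ) (hγ1 : γ < 1) (hδ : 0 < δ) (hδ1 : δ ≤ 1)
    (hc : 0 < c) (hck : c ≤ k)
    (hγdef : γ = 1 - (c ^ (1 / 2 : ℝ) * Γ / (d * T)) ^ (2 / 3 : ℝ))
    (hlam : lam = d * Real.log T) (hRT : R ≤ m * T)
    (hR : R ≤ 2 * m * Real.log T * Γ / (1 - γ)
        + 2 * beta d T S k m lam γ δ / Real.sqrt c * Real.sqrt (d * T)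
          * Real.sqrt (2 * max 1 (c / lam))
          * Real.sqrt (T * Real.log (1 / γ) + Real.log (1 + c / (d * lam * (1 - γ))))) :
    R ≤ rateConst S k m * Real.log (T / δ) ^ 4 * rateBound c d Γ T := by
  have hd1 : (1 : ℝ) ≤ d := by exact_mod_cast hd
  have hd0 : (0 : ℝ) < d := by linarith
  have hT2 : (2 : ℝ) ≤ T := by exact_mod_cast hT
  have hT0 : (0 : ℝ) < T := by linarith
  have hΓ0 : (0 : ℝ) ≤ Γ := Nat.cast_nonneg Γ
  have hk : 0 < k := hc.trans_le hck
  have hγ0 : 0 < γ := by linarith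
  have hlog2 : Real.log 2 ≤ Real.log T := Real.log_le_log (by norm_num) hT2
  have hℓ : 1 / 2 ≤ Real.log T := by linarith [Real.log_two_gt_d9]
  have hlam2 : 1 / 2 ≤ lam := by rw [hlam]; nlinarith
  have hlam0 : 0 < lam := by linarith
  set L := Real.log (T / δ) with hL
  have hLT : Real.log T ≤ L :=
    Real.log_le_log hT0 ((le_div_iff₀ hδ).2 (mul_le_of_le_one_right hT0.le hδ1))
  have hL2 : 1 / 2 ≤ L := hℓ.trans hLT
  have hL0 : 0 < L := by linarith
  set B := rateBound c d Γ T
  have hB0 : 0 ≤ B := rateBound_nonneg hc hd0 hΓ0 hT0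
  have hB3 : B ^ 3 = d ^ 2 * Γ * T ^ 2 / c := rateBound_pow_three hc hd0 hΓ0 hT0
  set η := 1 - γ with hη
  have hη0 : 0 < η := by linarith
  have hη3 : η ^ 3 = c * Γ ^ 2 / (d * T) ^ 2 :=
    tuning_pow_three hc hd0 hΓ0 hT0 (by rw [hη]; linarith)
  -- γ < 1 excludes Γ = 0.
  have hΓpos : (0 : ℝ) < Γ := by
    refine hΓ0.lt_of_ne fun h => ?_
    rw [← h] at hη3
    have : 0 < η ^ 3 := by positivity
    rw [hη3] at this
    simp at this
  have hΓ1 : (1 : ℝ) ≤ Γ := by exact_mod_cast Nat.cast_pos.1 hΓpos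
  have hL8 : 1 ≤ 8 * L ^ 3 := by linarith only [pow_le_pow_left₀ (by norm_num) hL2 3]
  have hL16 : 1 ≤ 16 * L ^ 4 := by linarith only [pow_le_pow_left₀ (by norm_num) hL2 4]
  set CW := 8 * (1 + (S + 2 * (2 * S * k + m))) + 2 * (1 / m + 8 * m + 2 * m * (4 * k + 1)) ^ 2
  have hCW : 0 ≤ CW := by positivity
  set C2 := 8 * k ^ 2 * (1 + 2 * k) * (4 * k + 5) * CW ^ 3
  have hC2 : 0 ≤ C2 := by positivity
  have hconst : rateConst S k m = 16 * m + Real.sqrt C2 := rfl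
  -- In cubes, this is the dichotomy T(1 − γ) < 1 or T(1 − γ) ≥ 1. In the first case T itself is at
  -- most the rate, so R ≤ mT suffices.
  rcases lt_or_ge (c * Γ ^ 2 * T) ((d : ℝ) ^ 2) with hcase | hcase
  · have hTB : T ≤ B := by
      refine le_of_pow_le_pow_left₀ (n := 3) (by norm_num) hB0 ?_
      rw [hB3, le_div_iff₀ hc]
      have h1 : c * T ≤ (d : ℝ) ^ 2 * Γ := by
        have h2 : c * T ≤ c * Γ ^ 2 * T := by
          have : (1 : ℝ) ≤ Γ ^ 2 := one_le_pow₀ hΓ1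
          nlinarith only [mul_pos hc hT0, this]
        have h3 : (d : ℝ) ^ 2 ≤ d ^ 2 * Γ := le_mul_of_one_le_right (by positivity) hΓ1
        linarith
      have := mul_le_mul_of_nonneg_right h1 (sq_nonneg (T : ℝ))
      linarith only [this]
    calc R ≤ m * T := hRT
      _ ≤ m * B := mul_le_mul_of_nonneg_left hTB hm.le
      _ ≤ m * B * (16 * L ^ 4) := le_mul_of_one_le_right (by positivity) hL16
      _ = 16 * m * L ^ 4 * B := by ring
      _ ≤ _ := by
          refine mul_le_mul_of_nonneg_right (mul_le_mul_of_nonneg_right ?_ (by positivity)) hB0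
          rw [hconst]
          linarith [Real.sqrt_nonneg C2]
  · have hTη : 1 ≤ T * η := by
      refine le_of_pow_le_pow_left₀ (n := 3) (by norm_num) (by positivity) ?_
      rw [one_pow, mul_pow, hη3]
      have : (T : ℝ) ^ 3 * (c * Γ ^ 2 / (d * T) ^ 2) = c * Γ ^ 2 * T / d ^ 2 := by field_simp
      rw [this, le_div_iff₀ (by positivity)]
      linarith
    have hΓη : Γ / η = B := by
      refine (pow_left_inj₀ (by positivity) hB0 (n := 3) (by norm_num)).1 ?_
      rw [hB3, div_pow, hη3]
      field_simp
    have hfirst : 2 * m * Real.log T * Γ / η ≤ 16 * m * L ^ 4 * B := by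
      have h1 : 2 * m * Real.log T * Γ / η = 2 * m * Real.log T * B := by rw [← hΓη]; ring
      have h2 : L ≤ 8 * L ^ 4 := by nlinarith only [hL8, hL0]
      rw [h1]
      refine mul_le_mul_of_nonneg_right ?_ hB0
      nlinarith only [mul_le_mul_of_nonneg_left (hLT.trans h2) hm.le]
    have hW := widthBase_le (δ := δ) hd hT hS hk.le hm hγ0 hγ1 hδ hδ1 hlam hL hLT hTη
    have hW1 : 1 ≤ widthBase d T S k m lam γ δ :=
      one_le_widthBase hS (by omega) hk.le hm hlam0 hγ0 hγ1 hδ hδ1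
    set W := widthBase d T S k m lam γ δ
    have hβ := beta_eq_sqrt (k := k) (S := S) (m := m) (d := d) (T := T) (γ := γ) (δ := δ) hlam0
      (zero_le_one.trans hW1)
    set J := T * Real.log (1 / γ) + Real.log (1 + c / (d * lam * η))
    -- 1/γ − 1 = η/γ ≤ 2η, because γ > 1/2.
    have hγlog : Real.log (1 / γ) ≤ 2 * η := by
      have h1 := Real.log_le_sub_one_of_pos (show 0 < 1 / γ by positivity)
      have h2 : 1 / γ - 1 ≤ 2 * η := by
        rw [sub_le_iff_le_add, div_le_iff₀ hγ0, hη]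
        nlinarith only [hγ, hγ1]
      linarith
    have hJ : J ≤ (4 * k + 5) * L * (T * η) := by
      have h1 := log_information_le hk.le (by linarith) hLT hL2 hd1 hlam2 hη0 hTη hc.le hck le_rfl
      have h2 : T * Real.log (1 / γ) ≤ 2 * (T * η) := by nlinarith only [hγlog, hT0]
      have h3 : 2 * (T * η) ≤ 4 * L * (T * η) := by nlinarith only [hL2, hTη]
      have h4 : (4 * k + 1) * L ≤ (4 * k + 1) * L * (T * η) :=
        le_mul_of_one_le_right (by positivity) hTη
      simp only [J]
      linarith
    have hJ0 : 0 ≤ J := by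
      have h1 : 0 ≤ Real.log (1 / γ) := Real.log_nonneg (by rw [le_div_iff₀ hγ0]; linarith)
      have h2 : 0 ≤ c / (d * lam * η) := by positivity
      have h3 : 0 ≤ Real.log (1 + c / (d * lam * η)) := Real.log_nonneg (by linarith)
      positivity
    have hmax : max 1 (c / lam) ≤ 1 + 2 * k := by
      refine max_le (by linarith) ?_
      rw [div_le_iff₀ hlam0]
      nlinarith only [hk, hck, hlam2]
    -- After squaring, λ and W³ contribute L·L⁶, `J` contributes L, and d²T²η/c = B². The root of L⁸
    -- is the final L⁴.
    have hsecond : 2 * beta d T S k m lam γ δ / Real.sqrt c * Real.sqrt (d * T)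
          * Real.sqrt (2 * max 1 (c / lam)) * Real.sqrt J ≤ Real.sqrt C2 * L ^ 4 * B := by
      refine le_of_sq_le_sq ?_ (by positivity)
      have hlamL : lam ≤ d * L := by rw [hlam]; exact mul_le_mul_of_nonneg_left hLT hd0.le
      have hβ2 : beta d T S k m lam γ δ ^ 2 ≤ k ^ 2 * (d * L * (CW * L ^ 2) ^ 3) := by
        rw [hβ, mul_pow, Real.sq_sqrt (by positivity)]
        refine mul_le_mul_of_nonneg_left ?_ (sq_nonneg k)
        exact mul_le_mul hlamL (pow_le_pow_left₀ (by linarith) hW 3) (by positivity)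
          (by positivity)
      have hBsq : B ^ 2 = d ^ 2 * T ^ 2 * η / c := by
        rw [← hΓη, div_pow, eq_div_iff hc.ne', div_mul_eq_mul_div, div_eq_iff (by positivity)]
        have : d ^ 2 * T ^ 2 * η * η ^ 2 = d ^ 2 * T ^ 2 * η ^ 3 := by ring
        rw [this, hη3]
        field_simp
      calc _ = 4 * beta d T S k m lam γ δ ^ 2 / c * (d * T) * (2 * max 1 (c / lam)) * J := by
            rw [mul_pow, mul_pow, mul_pow, div_pow, mul_pow, Real.sq_sqrt hc.le,
              Real.sq_sqrt (by positivity), Real.sq_sqrt (by positivity), Real.sq_sqrt hJ0]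
            norm_num
        _ ≤ 4 * (k ^ 2 * (d * L * (CW * L ^ 2) ^ 3)) / c * (d * T) * (2 * (1 + 2 * k))
            * ((4 * k + 5) * L * (T * η)) := by
            gcongr
        _ = C2 * L ^ 8 * (d ^ 2 * T ^ 2 * η / c) := by simp only [C2]; ring
        _ = (Real.sqrt C2 * L ^ 4 * B) ^ 2 := by
            rw [mul_pow, mul_pow, Real.sq_sqrt hC2, hBsq]; ring
    calc R ≤ _ := hR
      _ ≤ 16 * m * L ^ 4 * B + Real.sqrt C2 * L ^ 4 * B := add_le_add hfirst hsecond
      _ = _ := by rw [hconst]; ring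

end DGLUCB

/-! ### The main theorem. -/

theorem mainTheorem1 :
    -- the high-probability bounds: explicit form, and form with the factors `C₁`, `C₂`
    (∀ (d T Γ : ℕ) (S k m lam γ δ : ℝ),
      1 ≤ d → 1 ≤ T → 0 < m → 0 < lam → 1 / 2 < γ → γ < 1 → 0 < δ → δ ≤ 1 →
      ∀ (Ω : Type*) [MeasurableSpace Ω] (X : DGLUCB.Interaction d T Γ S k m Ω),
        X.IsDGLUCB lam γ δ →
        X.WithHighProb δ fun ω =>
          X.regret ω ≤
              2 * m * Real.log T * Γ / (1 - γ)
              + 2 * k * (2 * S * k + m) / lam * (1 / (1 - γ))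
              + 2 * DGLUCB.beta d T S k m lam γ δ / Real.sqrt X.cμ * Real.sqrt (d * T)
                * Real.sqrt (2 * max 1 (X.cμ / lam))
                * Real.sqrt (T * Real.log (1 / γ)
                    + Real.log (1 + X.cμ / (d * lam * (1 - γ)))) ∧
          X.regret ω ≤
              DGLUCB.C₁ T S k m lam * (Γ / (1 - γ))
              + DGLUCB.C₂ k lam
                * (DGLUCB.beta d T S k m lam γ δ * Real.sqrt (d * T) / Real.sqrt X.cμ)
                * Real.sqrt (T * Real.log (1 / γ)
                    + Real.log (1 + 1 / (d * lam * (1 - γ))))) ∧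
    -- the rate for the tuned parameters
    (∃ p : ℕ, ∀ S k m : ℝ, 0 < m → ∃ K : ℝ,
      ∀ (d T Γ : ℕ) (lam γ δ : ℝ),
        1 ≤ d → 2 ≤ T → 1 / 2 < γ → γ < 1 → 0 < δ → δ ≤ 1 →
        ∀ (Ω : Type*) [MeasurableSpace Ω] (X : DGLUCB.Interaction d T Γ S k m Ω),
          γ = 1 - (X.cμ ^ (1 / 2 : ℝ) * Γ / (d * T)) ^ (2 / 3 : ℝ) →
          lam = d * Real.log T →
          X.IsDGLUCB lam γ δ →
          X.WithHighProb δ fun ω =>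
            X.regret ω ≤ K * Real.log (T / δ) ^ p *
              (X.cμ ^ (-(1 / 3) : ℝ) * (d : ℝ) ^ (2 / 3 : ℝ) * (Γ : ℝ) ^ (1 / 3 : ℝ)
                * (T : ℝ) ^ (2 / 3 : ℝ))) := by
  refine ⟨?_, 4, fun S k m hm => ⟨DGLUCB.rateConst S k m, ?_⟩⟩
  · intro d T Γ S k m lam γ δ hd hT hm hlam hγ hγ1 hδ hδ1 Ω _ X hX
    have hγ0 : 0 < γ := by linarith
    have h1γ : 0 < 1 - γ := by linarith
    have hS := X.radius_nonneg hT
    have hc := X.toRewardModel.cμ_pos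
    have hck := X.toRewardModel.cμ_le hS
    have hk : 0 < k := hc.trans_le hck
    have hβ := X.beta_nonneg hT hlam hm hγ0 hγ1 hδ hδ1
    refine (X.regret_withHighProb hd hT hm hlam hγ hγ1 hδ hδ1 hX).mono fun ω hω => ⟨?_, ?_⟩
    -- The bias is already inside S̄, hence inside β, so this summand is pure slack.
    · have h1 : 0 ≤ 2 * k * (2 * S * k + m) / lam * (1 / (1 - γ)) := by positivity
      linarith
    -- The same slack now carries a factor Γ; even for Γ = 0 nothing is lost, since the underlying
    -- bound has no separate bias term.
    · have h1 : 0 ≤ 2 * k * (2 * S * k + m) / lam * (Γ / (1 - γ)) := by positivity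
      have h2 := DGLUCB.width_term_le (d := d) (T := T) hc hck hlam hγ0 hγ1
      have h3 := mul_le_mul_of_nonneg_left h2
        (show 0 ≤ 2 * DGLUCB.beta d T S k m lam γ δ / Real.sqrt X.cμ * Real.sqrt (d * T) by
          positivity)
      refine hω.trans ?_
      rw [DGLUCB.C₁, DGLUCB.C₂]
      calc _ ≤ _ := add_le_add_right ((mul_assoc _ _ _).le.trans h3) _
        _ ≤ 2 * m * Real.log T * Γ / (1 - γ)
            + 2 * k * (2 * S * k + m) / lam * (Γ / (1 - γ)) + _ :=
          add_le_add_left (le_add_of_nonneg_right h1) _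
        _ = _ := by ring
  · intro d T Γ lam γ δ hd hT hγ hγ1 hδ hδ1 Ω _ X hγdef hlam hX
    have hT1 : 1 ≤ T := by omega
    have hlam0 : 0 < lam := by
      rw [hlam]
      have : 0 < Real.log T := Real.log_pos (by exact_mod_cast hT)
      have hd0 : (0 : ℝ) < d := by exact_mod_cast hd
      positivity
    have hS := X.radius_nonneg hT1
    exact (X.regret_withHighProb hd hT1 hm hlam0 hγ hγ1 hδ hδ1 hX).mono fun ω hω =>
      DGLUCB.bound_le_rate hd hT hS hm hγ hγ1 hδ hδ1 X.toRewardModel.cμ_pos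
        (X.toRewardModel.cμ_le hS) hγdef hlam (X.regret_le ω) hω
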